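/- **Setting.** Let $\alpha\in(1,2]$ and let $L=(L^1,\dots,L^d)^T$, $d\ge 1$, be a $d$-dimensional Lévy process with respect to a filtration $(\mathcal F_t)_{t\ge0}$ (for instance the one generated by $L$): $L$ is adapted, $L_0=0$ a.s., $L$ has a.s. càdlàg paths, and $L_t-L_s$ is independent of $\mathcal F_s$ and distributed as $L_{t-s}$ for $s\le t$. Assume that $L$ is $\alpha$-stable, i.e. $t^{-1/\alpha}L_t\overset d=L_1$ for all $t>0$, and not a.s. zero. If $\alpha<2$, $L$ has the Lévy measure $$\lambda f=\int_0^\infty\int_{\mathbb S^d}\frac{c}{w^{\alpha+1}}f(wv)\,\tilde\sigma(\mathrm dv)\,\mathrm dw$$ with $c>0$ and a probability measure $\tilde\sigma$ on the unit sphere $\mathbb S^d$ of $\mathbb R^d$. If $\alpha=2$, $L=W$ is a Brownian motion: $W_t$ is Gaussian and $W^j_t\sim\mathcal N(0,t)$ for every $j$; put $R_t=(\mathrm{Corr}(W^j_t,W^l_t))_{j,l}$ and assume that $R_t$ is positive definite for $t\in(0,T]$. Let $r\in\mathbb R$, let $\mu_t\in\mathbb R^d$ and $\sigma_t\in\mathbb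 R^{d\times d}$ be deterministic and continuous in $t\in[0,T]$, with $\sigma_t$ symmetric, positive definite and with positive entries. Let $0=t_0<t_1<\dots<t_N=T$ be a grid (for instance $t_k=k$ and $T\in\mathbb N$), let $n\in\{t_0,\dots,t_{N-1}\}$, and let $\tilde{\mathcal U}$ be the set of deterministic functions $u:(0,T]\to[-M,M]^d$, $M>0$, that are constant on each interval $(t_{k-1},t_k]$. For $u\in\tilde{\mathcal U}$ the wealth process $X^u$ solves $$\mathrm dX^u_t=\Big[rX^u_t+\sum_{i}u^i_t(\mu^i_t-r)\Big]\mathrm dt+\sum_{i,j}u^i_t\sigma^{ij}_t\,\mathrm dL^j_t ,$$ started at some time $a\le n$ with an $\mathcal F_a$-measurable value. A risk measure is a map $\rho:\mathcal R\to\mathbb R\cup\{+\infty\}$ on a convex set $\mathcal R$ of random variables that contains $\mathcal L^\alpha(\mathcal F_T)$ and is closed under multiplication by constants $\beta\ge0$ and addition of constants, such that $\rho$ is law-invariant, $\rho(\beta Y)=\beta\rho(Y)$ for $\beta\ge 0$ (with $0\cdot\infty=0$), and either $\rho(Y+m)=\rho(Y)-m$ for all $m\in\mathbb R$ (cash-invariant)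 or $\rho(Y+m)=\rho(Y)$ for all $m\in\mathbb R$ (shift-invariant). Let $\rho'$ be the induced functional on laws of elements of $\mathcal R$; set $\varrho^{Z}=\rho'(\text{law of }Z)$. The conditional risk $\rho_{n,x}(Y)$ is $\rho'$ applied to the conditional law of $Y$ given $X^u_n=x$, and $\rho_n(Y)$ is $\rho'$ applied to the conditional law of $Y$ given $\mathcal F_n$. Put $m_s(u)=u_s^T(\mu_s-r)e^{r(T-s)}$ if $\rho$ is cash-invariant and $m_s(u)=0$ if $\rho$ is shift-invariant. For $\alpha<2$ let $\tilde L$ be a one-dimensional symmetric $\alpha$-stable Lévy process with the same constant $c$ as $L$. Consider the three cases * (A) $\alpha<2$ and $L\overset d=-L$: $\hat L=\tilde L$ and $w_s(u)=\|u_s^T\sigma_s v\,e^{r(T-s)}\|_{L^\alpha(\mathbb S^d,\tilde\sigma(\mathrm dv))}$; * (B) $\alpha<2$, $d=1$ and $u\ge0$: $\hat L=L^1$ and $w_s(u)=u^1_s\sigma^{11}_se^{r(T-s)}$; * (C) $\alpha=2$: $\hat L=W^1$ and $w_s(u)=\sqrt{x R_s x^T}$ with the row vector $x=u_s^T\sigma_se^{r(T-s)}$;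 and assume that $\varrho^{\hat L_1}<\infty$ (in particular, some element of $\mathcal R$ has the law of $\hat L_1$). **Proposition.** In each of the cases (A), (B), (C), for every $u\in\tilde{\mathcal U}$ (non-negative in case (B)), the function $s\mapsto m_s(u)$ is integrable over $(n,T]$, all norms below are finite, and $$\rho_{n,x}\big(X^u_T-xe^{r(T-n)}\big)=-\int_n^Tm_s(u)\,\mathrm ds+\varrho^{\hat L_1}\,\mathcal N=-\int_n^Tm_s(u)\,\mathrm ds+\varrho^{\hat L_1}\,\|w_s(u)\|_{L^\alpha((n,T],\mathrm ds)}$$ for almost every $x$ with respect to the law of $X^u_n$ (in particular for every fixed $x\in\mathbb R$ if $X^u$ is started at time $n$ with $X^u_n=x$), and likewise $\rho_n(X^u_T-X^u_ne^{r(T-n)})$ equals the same number almost surely, where $$\mathcal N=\begin{cases}\|u_s^T\sigma_sv\,e^{r(T-s)}\|_{L^\alpha((n,T]\times\mathbb S^d,\ \mathrm ds\times\tilde\sigma(\mathrm dv))}&\text{in case (A)},\\ \|u^1_s\sigma^{11}_se^{r(T-s)}\|_{L^\alpha((n,T],\mathrm ds)}&\text{in case (B)},\\ \sqrt{\int_n^T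 x_sR_sx_s^T\,\mathrm ds},\quad x_s=u_s^T\sigma_se^{r(T-s)},&\text{in case (C)}.\end{cases}$$ -/

import Mathlib

open MeasureTheory ProbabilityTheory Filter Topology Set
open scoped NNReal ENNReal Matrix RealInnerProductSpace

noncomputable section

/-! ### Lévy processes and stability -/

/-- `L` is a Lévy process with respect to the filtration `ℱ`: it is adapted, starts at `0`, has
càdlàg paths almost surely, its increments after time `s` are independent of `ℱ s`, and they are
stationary. (For the filtration generated by `L` the fourth property is the independence of the
increments.) -/
structure IsLevyProcess {Ω E : Type*} {mΩ : MeasurableSpace Ω} [NormedAddCommGroup E]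
    [MeasurableSpace E] (ℱ : Filtration ℝ≥0 mΩ) (L : ℝ≥0 → Ω → E) (P : Measure Ω) : Prop where
  adapted : Adapted ℱ L
  zero : ∀ᵐ ω ∂P, L 0 ω = 0
  cadlag : ∀ᵐ ω ∂P, ∀ t : ℝ≥0, ContinuousWithinAt (fun s => L s ω) (Ici t) t ∧
    ∃ l : E, Tendsto (fun s => L s ω) (𝓝[<] t) (𝓝 l)
  indep : ∀ s t : ℝ≥0, s ≤ t →
    Indep (MeasurableSpace.comap (fun ω => L t ω - L s ω) inferInstance) (ℱ s) P
  stationary : ∀ s h : ℝ≥0, IdentDistrib (fun ω => L (s + h) ω - L s ω) (L h) P P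

/-- The measure `λ f = ∫_{w > 0} ∫_{v ∈ sphere} c / w ^ (α + 1) * f (w v) ν(dv) dw`. -/
def stableLevyMeasure {E : Type*} [NormedAddCommGroup E] [InnerProductSpace ℝ E]
    [MeasurableSpace E] (α c : ℝ) (ν : Measure (Metric.sphere (0 : E) 1)) : Measure E :=
  Measure.map (fun p : ℝ × Metric.sphere (0 : E) 1 => p.1 • (p.2 : E))
    (((volume.restrict (Ioi (0 : ℝ))).withDensity
      (fun w => ENNReal.ofReal (c / w ^ (α + 1)))).prod ν)

/-- `Λ` is the Lévy measure of the Lévy process `L`, through the Lévy-Khintchine representation of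
the characteristic functions of the `L t`, with some drift `b` and some Gaussian covariance `A`. -/
def HasLevyMeasure {Ω E : Type*} {mΩ : MeasurableSpace Ω} [NormedAddCommGroup E]
    [InnerProductSpace ℝ E] [MeasurableSpace E]
    (L : ℝ≥0 → Ω → E) (P : Measure Ω) (Λ : Measure E) : Prop :=
  Λ {0} = 0 ∧ ∫⁻ x, ENNReal.ofReal (min 1 (‖x‖ ^ 2)) ∂Λ < ∞ ∧
  ∃ (b : E) (A : E →L[ℝ] E), A.IsPositive ∧ ∀ (t : ℝ≥0) (ξ : E),
    charFun (P.map (L t)) ξ = Complex.exp ((t : ℝ) *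
      (Complex.I * (⟪b, ξ⟫ : ℝ) - ((1 / 2 * ⟪A ξ, ξ⟫ : ℝ) : ℂ) +
        ∫ x, (Complex.exp (Complex.I * (⟪ξ, x⟫ : ℝ)) - 1 -
          Complex.I * (if ‖x‖ ≤ 1 then ⟪ξ, x⟫ else 0 : ℝ)) ∂Λ))

/-- `t ^ (-1 / α) L_t` has the law of `L_1` for all `t > 0`, and `L` is not almost surely zero. -/
structure IsAlphaStable {Ω E : Type*} {mΩ : MeasurableSpace Ω} [NormedAddCommGroup E]
    [NormedSpace ℝ E] [MeasurableSpace E] (α : ℝ) (L : ℝ≥0 → Ω → E) (P : Measure Ω) : Prop where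
  scaling : ∀ t : ℝ≥0, 0 < t →
    IdentDistrib (fun ω => ((t : ℝ) ^ (-(1 / α))) • L t ω) (L 1) P P
  nontrivial : ¬ ∀ᵐ ω ∂P, ∀ t : ℝ≥0, L t ω = 0

/-- `L` and `-L` are equal in law (for Lévy processes: if and only if the one-dimensional marginal
laws agree). -/
def IsSymmetricProcess {Ω E : Type*} {mΩ : MeasurableSpace Ω} [NormedAddCommGroup E]
    [MeasurableSpace E] (L : ℝ≥0 → Ω → E) (P : Measure Ω) : Prop :=
  ∀ t : ℝ≥0, IdentDistrib (L t) (fun ω => - L t ω) P P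

/-- The marginal laws of a `d`-dimensional Brownian motion whose components are standard
one-dimensional Brownian motions, possibly correlated. -/
def HasBrownianMarginals {Ω : Type*} {mΩ : MeasurableSpace Ω} {d : ℕ}
    (W : ℝ≥0 → Ω → EuclideanSpace ℝ (Fin d)) (P : Measure Ω) : Prop :=
  ∀ t : ℝ≥0, IsGaussian (P.map (W t)) ∧
    ∀ j : Fin d, P.map (fun ω => W t ω j) = gaussianReal 0 t

/-- The matrix `R_t` with entries `Corr (W_t^j, W_t^l)`. -/
def corrMatrix {Ω : Type*} {mΩ : MeasurableSpace Ω} {d : ℕ}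
    (W : ℝ≥0 → Ω → EuclideanSpace ℝ (Fin d)) (P : Measure Ω) (t : ℝ≥0) :
    Matrix (Fin d) (Fin d) ℝ :=
  Matrix.of fun j l => cov[fun ω => W t ω j, fun ω => W t ω l; P] /
    (√(Var[fun ω => W t ω j; P]) * √(Var[fun ω => W t ω l; P]))

/-! ### Stochastic integrals of deterministic functions -/

/-- A left-continuous step function on `(a, b]`: the value is `value k` on
`(node k, node (k + 1)]`. -/
structure StepFunction (a b : ℝ≥0) where
  size : ℕ
  node : Fin (size + 1) → ℝ≥0
  mono : Monotone node
  first : node 0 = a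
  last : node (Fin.last size) = b
  value : Fin size → ℝ

/-- The value of a step function at `s`. -/
def StepFunction.eval {a b : ℝ≥0} (φ : StepFunction a b) (s : ℝ≥0) : ℝ :=
  ∑ k, (Ioc (φ.node k.castSucc) (φ.node k.succ)).indicator (fun _ => φ.value k) s

/-- The elementary integral `∫_{a+}^t φ dZ`. -/
def StepFunction.integral {Ω : Type*} {a b : ℝ≥0} (φ : StepFunction a b) (Z : ℝ≥0 → Ω → ℝ)
    (t : ℝ≥0) (ω : Ω) : ℝ :=
  ∑ k, φ.value k * (Z (min (φ.node k.succ) t) ω - Z (min (φ.node k.castSucc) t) ω)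

/-- Uniform convergence in probability on `[a, b]`. (The measure of a set that is not measurable is
its outer measure.) -/
def TendstoUCP {Ω : Type*} {mΩ : MeasurableSpace Ω} (P : Measure Ω) (a b : ℝ≥0)
    (Y : ℕ → ℝ≥0 → Ω → ℝ) (I : ℝ≥0 → Ω → ℝ) : Prop :=
  ∀ ε : ℝ, 0 < ε →
    Tendsto (fun n => P {ω | ∃ t ∈ Icc a b, ε ≤ |Y n t ω - I t ω|}) atTop (𝓝 0)

/-- The process `I_t = ∫_{a+}^t H dZ`, `t ∈ [a, b]`, is the stochastic integral of the deterministic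
function `H`: the integral is the extension of the elementary integral from step functions with the
supremum distance to processes with the ucp distance. (Every left-continuous function with right
limits on `[a, b]` is a uniform limit of step functions.) -/
def IsStochasticIntegral {Ω : Type*} {mΩ : MeasurableSpace Ω} (P : Measure Ω) (a b : ℝ≥0)
    (H : ℝ≥0 → ℝ) (Z : ℝ≥0 → Ω → ℝ) (I : ℝ≥0 → Ω → ℝ) : Prop :=
  (∃ φ : ℕ → StepFunction a b,
    TendstoUniformlyOn (fun n => (φ n).eval) H atTop (Ioc a b)) ∧
  ∀ φ : ℕ → StepFunction a b, TendstoUniformlyOn (fun n => (φ n).eval) H atTop (Ioc a b) →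
    TendstoUCP P a b (fun n => (φ n).integral Z) I

/-! ### The market, the controls and the wealth process -/

/-- The coefficients of the market: continuous drift `μ` and continuous volatility matrix `σ`, with
positive entries, symmetric and positive definite. -/
structure IsMarket {d : ℕ} (T : ℝ≥0) (μ : ℝ≥0 → Fin d → ℝ)
    (σ : ℝ≥0 → Matrix (Fin d) (Fin d) ℝ) : Prop where
  continuous_drift : ContinuousOn μ (Icc 0 T)
  continuous_vol : ContinuousOn σ (Icc 0 T)
  pos : ∀ t ∈ Icc 0 T, ∀ i j, 0 < σ t i j
  posDef : ∀ t ∈ Icc 0 T, (σ t).PosDef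

/-- `0 = t_0 < t_1 < ... < t_N = T`. -/
structure IsGrid (T : ℝ≥0) {N : ℕ} (grid : Fin (N + 1) → ℝ≥0) : Prop where
  strictMono : StrictMono grid
  first : grid 0 = 0
  last : grid (Fin.last N) = T

/-- A deterministic control bounded by `M`, constant on the intervals `(t_k, t_{k + 1}]`. -/
structure IsControl {d N : ℕ} (M : ℝ) (grid : Fin (N + 1) → ℝ≥0) (u : ℝ≥0 → Fin d → ℝ) :
    Prop where
  const : ∀ k : Fin N, ∃ v : Fin d → ℝ, ∀ s ∈ Ioc (grid k.castSucc) (grid k.succ), u s = v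
  bounded : ∀ k : Fin N, ∀ s ∈ Ioc (grid k.castSucc) (grid k.succ), ∀ i, |u s i| ≤ M

/-- `X` solves `dX = [r X + ∑ i, u^i (μ^i - r)] dt + ∑ i j, u^i σ^{ij} dL^j` on `[a, T]`, and its
initial value at time `a` is known at time `a`. (Such a solution has càdlàg paths almost surely.) -/
structure IsWealthProcess {Ω : Type*} {mΩ : MeasurableSpace Ω} {d : ℕ} (P : Measure Ω)
    (ℱ : Filtration ℝ≥0 mΩ) (L : ℝ≥0 → Ω → EuclideanSpace ℝ (Fin d)) (r : ℝ)
    (μ : ℝ≥0 → Fin d → ℝ) (σ : ℝ≥0 → Matrix (Fin d) (Fin d) ℝ) (u : ℝ≥0 → Fin d → ℝ)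
    (a T : ℝ≥0) (X : ℝ≥0 → Ω → ℝ) : Prop where
  aemeasurable : ∀ t ∈ Icc a T, AEMeasurable (X t) P
  initial : Measurable[ℱ a] (X a)
  equation : ∃ I : Fin d → Fin d → ℝ≥0 → Ω → ℝ,
    (∀ i j, IsStochasticIntegral P a T (fun s => u s i * σ s i j) (fun t ω => L t ω j) (I i j)) ∧
    ∀ᵐ ω ∂P, IntervalIntegrable (fun s : ℝ => X s.toNNReal ω) volume a T ∧
      ∀ t ∈ Icc a T, X t ω = X a ω +
        (∫ s in (a : ℝ)..t, (r * X s.toNNReal ω +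
          ∑ i, u s.toNNReal i * (μ s.toNNReal i - r))) +
        ∑ i, ∑ j, I i j t ω

/-! ### Risk measures -/

/-- The two kinds of translation behaviour of a risk measure. -/
inductive TranslationKind
  | cashInvariant
  | shiftInvariant

/-- A risk measure on a convex set `dom` of random variables that contains `L^α (ℱ T)`, with values in `ℝ ∪ {+∞}`: law-invariant, positively homogeneous (with `0 * ∞ = 0`), and
cash-invariant or shift-invariant. -/
structure RiskMeasure {Ω : Type*} {mΩ : MeasurableSpace Ω} (P : Measure Ω)
    (ℱ : Filtration ℝ≥0 mΩ) (T : ℝ≥0) (α : ℝ) (kind : TranslationKind) where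
  dom : Set (Ω → ℝ)
  toFun : (Ω → ℝ) → EReal
  measurable : ∀ Y ∈ dom, Measurable Y
  convex : Convex ℝ dom
  contains_Lp : ∀ Y : Ω → ℝ, Measurable[ℱ T] Y → MemLp Y (ENNReal.ofReal α) P → Y ∈ dom
  ne_bot : ∀ Y ∈ dom, toFun Y ≠ ⊥
  law_invariant : ∀ Y₁ ∈ dom, ∀ Y₂ ∈ dom, IdentDistrib Y₁ Y₂ P P → toFun Y₁ = toFun Y₂
  smul_mem : ∀ Y ∈ dom, ∀ β : ℝ, 0 ≤ β → (fun ω => β * Y ω) ∈ dom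
  pos_homogeneous : ∀ Y ∈ dom, ∀ β : ℝ, 0 ≤ β → toFun (fun ω => β * Y ω) = (β : EReal) * toFun Y
  add_const_mem : ∀ Y ∈ dom, ∀ m : ℝ, (fun ω => Y ω + m) ∈ dom
  translation : ∀ Y ∈ dom, ∀ m : ℝ, toFun (fun ω => Y ω + m) =
    match kind with
    | .cashInvariant => toFun Y - (m : EReal)
    | .shiftInvariant => toFun Y

open Classical in
/-- The functional `ρ'` on laws that is induced by the law-invariant `ρ`: `ρ' (law of Y) = ρ Y` for
`Y` in the domain of `ρ`. It is `+∞` on laws that no element of the domain has. -/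
def RiskMeasure.ofLaw {Ω : Type*} {mΩ : MeasurableSpace Ω} {P : Measure Ω}
    {ℱ : Filtration ℝ≥0 mΩ} {T : ℝ≥0} {α : ℝ} {kind : TranslationKind}
    (ρ : RiskMeasure P ℱ T α kind)
    (η : Measure ℝ) : EReal :=
  if h : ∃ Y ∈ ρ.dom, P.map Y = η then ρ.toFun h.choose else ⊤

theorem RiskMeasure.ofLaw_map {Ω : Type*} {mΩ : MeasurableSpace Ω} {P : Measure Ω}
    {ℱ : Filtration ℝ≥0 mΩ} {T : ℝ≥0} {α : ℝ} {kind : TranslationKind}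
    (ρ : RiskMeasure P ℱ T α kind)
    {Y : Ω → ℝ} (hY : Y ∈ ρ.dom) : ρ.ofLaw (P.map Y) = ρ.toFun Y := by
  have h : ∃ Z ∈ ρ.dom, P.map Z = P.map Y := ⟨Y, hY, rfl⟩
  rw [RiskMeasure.ofLaw, dif_pos h]
  exact ρ.law_invariant _ h.choose_spec.1 _ hY
    ⟨(ρ.measurable _ h.choose_spec.1).aemeasurable, (ρ.measurable _ hY).aemeasurable,
      h.choose_spec.2⟩

/-- A regular version of the conditional law of `Y` given the σ-algebra `m`. -/
def condLaw {Ω : Type*} {mΩ : MeasurableSpace Ω} (P : Measure Ω) [IsFiniteMeasure P]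
    (m : MeasurableSpace Ω) (Y : Ω → ℝ) (ω : Ω) : Measure ℝ :=
  @condDistrib Ω Ω ℝ _ _ _ mΩ m Y id P _ ω

theorem condLaw_ae_eq_condExp {Ω : Type*} (m : MeasurableSpace Ω) {mΩ : MeasurableSpace Ω}
    (P : Measure Ω) [IsFiniteMeasure P] (hm : m ≤ mΩ) {Y : Ω → ℝ} (hY : Measurable Y)
    {s : Set ℝ} (hs : MeasurableSet s) :
    (fun ω => (condLaw P m Y ω).real s) =ᵐ[P] P⟦Y ⁻¹' s | m⟧ := by
  have := @condDistrib_ae_eq_condExp Ω Ω ℝ _ _ _ mΩ P _ id Y m s (fun _ h => hm _ h) hY hs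
  rwa [MeasurableSpace.comap_id] at this

/-- `ρ_n (X_T - e^{r (T - n)} X_n) = value` almost surely, where the conditional risk measure is
`ρ'` of the conditional law given `ℱ n`, and `ρ_{n, x} (X_T - x e^{r (T - n)}) = value` for
almost all `x` under the law of `X_n`, where it is `ρ'` of the conditional law given `X_n = x`. -/
def ConditionalRiskEq {Ω : Type*} {mΩ : MeasurableSpace Ω} {P : Measure Ω} [IsFiniteMeasure P]
    {ℱ : Filtration ℝ≥0 mΩ} {T : ℝ≥0} {α : ℝ} {kind : TranslationKind}
    (ρ : RiskMeasure P ℱ T α kind) (r : ℝ) (X : ℝ≥0 → Ω → ℝ) (n : ℝ≥0) (value : EReal) : Prop :=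
  (∀ᵐ ω ∂P, ρ.ofLaw (condLaw P (ℱ n)
    (fun ω' => X T ω' - X n ω' * Real.exp (r * (T - n))) ω) = value) ∧
  (∀ᵐ x ∂(P.map (X n)), ρ.ofLaw
    ((condDistrib (X T) (X n) P x).map (fun y => y - x * Real.exp (r * (T - n)))) = value)

/-! ### The functions `m` and `w` -/

/-- `m_s (u) = u_s^T (μ_s - r) e^{r (T - s)}` for cash-invariant, `0` for shift-invariant risk
measures. -/
def driftTerm {d : ℕ} (kind : TranslationKind) (r : ℝ) (T : ℝ≥0) (μ : ℝ≥0 → Fin d → ℝ)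
    (u : ℝ≥0 → Fin d → ℝ) (s : ℝ≥0) : ℝ :=
  match kind with
  | .cashInvariant => (∑ i, u s i * (μ s i - r)) * Real.exp (r * (T - s))
  | .shiftInvariant => 0

/-- The row vector `u_s^T σ_s e^{r (T - s)}`. -/
def discountedVol {d : ℕ} (r : ℝ) (T : ℝ≥0) (σ : ℝ≥0 → Matrix (Fin d) (Fin d) ℝ)
    (u : ℝ≥0 → Fin d → ℝ) (s : ℝ≥0) : Fin d → ℝ :=
  Real.exp (r * (T - s)) • (u s ᵥ* σ s)

/-- The scalar `u_s^T σ_s v e^{r (T - s)}` for `v` in the unit sphere. -/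
def discountedVolAlong {d : ℕ} (r : ℝ) (T : ℝ≥0) (σ : ℝ≥0 → Matrix (Fin d) (Fin d) ℝ)
    (u : ℝ≥0 → Fin d → ℝ) (s : ℝ≥0) (v : Metric.sphere (0 : EuclideanSpace ℝ (Fin d)) 1) : ℝ :=
  ∑ j, discountedVol r T σ u s j * (v : EuclideanSpace ℝ (Fin d)) j

/-- `w_s (u)` in the symmetric case `α < 2`: the `L^α (ν)` norm of `v ↦ u_s^T σ_s v e^{r (T - s)}`
over the unit sphere. -/
def weightSymmetric {d : ℕ} (α r : ℝ) (T : ℝ≥0)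
    (ν : Measure (Metric.sphere (0 : EuclideanSpace ℝ (Fin d)) 1))
    (σ : ℝ≥0 → Matrix (Fin d) (Fin d) ℝ) (u : ℝ≥0 → Fin d → ℝ) (s : ℝ≥0) : ℝ :=
  lpNorm (discountedVolAlong r T σ u s) (ENNReal.ofReal α) ν

/-- `w_s (u)` in the one-dimensional case `α < 2`: `u_s^1 σ_s^{11} e^{r (T - s)}`. -/
def weightOneDim {d : ℕ} [NeZero d] (r : ℝ) (T : ℝ≥0) (σ : ℝ≥0 → Matrix (Fin d) (Fin d) ℝ)
    (u : ℝ≥0 → Fin d → ℝ) (s : ℝ≥0) : ℝ :=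
  u s 0 * σ s 0 0 * Real.exp (r * (T - s))

/-- `w_s (u)` in the case `α = 2`: the norm `√(x R_s x^T)` of the row vector
`x = u_s^T σ_s e^{r (T - s)}`. -/
def weightBrownian {d : ℕ} (R : ℝ≥0 → Matrix (Fin d) (Fin d) ℝ) (r : ℝ) (T : ℝ≥0)
    (σ : ℝ≥0 → Matrix (Fin d) (Fin d) ℝ) (u : ℝ≥0 → Fin d → ℝ) (s : ℝ≥0) : ℝ :=
  √(discountedVol r T σ u s ⬝ᵥ (R s *ᵥ discountedVol r T σ u s))

/-- The number `- ∫_n^T m_s (u) ds + ϱ * norm`. -/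
def riskValue {d : ℕ} (kind : TranslationKind) (r : ℝ) (μ : ℝ≥0 → Fin d → ℝ)
    (u : ℝ≥0 → Fin d → ℝ) (n T : ℝ≥0) (ϱ : EReal) (norm : ℝ) : EReal :=
  ((-∫ s in (n : ℝ)..T, driftTerm kind r T μ u s.toNNReal : ℝ) : EReal) + ϱ * (norm : EReal)

end

noncomputable section

/-! ### Characteristic functions of stable Lévy processes -/

/-! The wealth equation is linear, so pathwise variation of constants writes `X T - e^{r (T - n)} X
n` as a deterministic drift integral plus a stochastic part, formally `∫ e^{r (T - s)} u_s^T σ_s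
dL_s` over `(n, T]`. Along suitable refining partitions the stochastic part is the almost sure limit
of sums `∑ ⟪L (t (i + 1)) - L (t i), x i⟫` with deterministic directions `x i`
(`IsWealthProcess.exists_tendsto_sum`). Only step-function integrals, an almost surely uniform
subsequence and integration by parts enter.

The characteristic function of such a sum, tested against any bounded variable known at time `n`,
factorises over the increments. Self-similarity turns the increment over a cell of length `Δ` into
`L 1` scaled by `Δ ^ (1 / α)`. A weight function `w` (`IsWeight`) replaces `⟪L 1, x⟫` by `w x` times
a variable of a fixed one-dimensional law `Q`. Strict stability of `Q` then collapses the product to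
`charFun Q ((∑ w (x i) ^ α * Δ i) ^ (1 / α) * η)`, whose inner sum is a Riemann sum of `∫ w ^ α`.
Hence the stochastic part is independent of `ℱ n` and has the law of `κ Z`, where `Z` has law `Q`
and `κ` is the `L^α` norm of the weight (`IsWealthProcess.map_restrict_stochasticPart`).

Both conditional laws are therefore constant, and positive homogeneity together with the translation
rule gives the value of the risk (`IsWealthProcess.conditionalRiskEq`).

The three cases differ only in `Q`, the admissible cone and `w`. In the symmetric case the
Lévy-Khintchine formula yields the characteristic function `exp (-C ∫ |⟪ξ, v⟫| ^ α)`
(`isWeight_symmetric`). For one asset the half-line of nonnegative positions suffices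
(`isWeight_oneDim`). In the Brownian case the weight is the standard deviation of a centred Gaussian
functional, and scaling makes the correlation matrix independent of time
(`HasBrownianMarginals.isWeight`, `HasBrownianMarginals.corrMatrix_eq`). -/

theorem IsLevyProcess.measurable {Ω E : Type*} {mΩ : MeasurableSpace Ω} [NormedAddCommGroup E]
    [MeasurableSpace E] {ℱ : Filtration ℝ≥0 mΩ} {L : ℝ≥0 → Ω → E} {P : Measure Ω}
    (hL : IsLevyProcess ℱ L P) (t : ℝ≥0) : Measurable (L t) :=
  (hL.adapted t).mono (ℱ.le t) le_rfl

section Levy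

variable {Ω E : Type*} {mΩ : MeasurableSpace Ω} [NormedAddCommGroup E] [InnerProductSpace ℝ E]
  [MeasurableSpace E] [BorelSpace E] [SecondCountableTopology E] {ℱ : Filtration ℝ≥0 mΩ}
  {L : ℝ≥0 → Ω → E} {P : Measure Ω}

/-- The increment is independent of `ℱ s` and stationary. The free factor `V` stands for arbitrary
information at time `s`, so that the identity later yields independence from the past and not only a
law. -/
theorem IsLevyProcess.integral_mul_exp_increment (hL : IsLevyProcess ℱ L P) {s t : ℝ≥0}
    (hst : s ≤ t) {V : Ω → ℂ} (hV : Measurable[ℱ s] V) (ξ : E) :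
    ∫ ω, V ω * Complex.exp (⟪L t ω - L s ω, ξ⟫ * Complex.I) ∂P =
      (∫ ω, V ω ∂P) * charFun (P.map (L (t - s))) ξ := by
  have hinc : Measurable fun ω => L t ω - L s ω := (hL.measurable t).sub (hL.measurable s)
  have hexp : Measurable fun x : E => Complex.exp ((⟪x, ξ⟫ : ℝ) * Complex.I) := by fun_prop
  have hind : IndepFun V (fun ω => Complex.exp ((⟪L t ω - L s ω, ξ⟫ : ℝ) * Complex.I)) P := by
    have h1 : IndepFun (fun ω => L t ω - L s ω) V P := by
      rw [IndepFun_iff_Indep]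
      exact indep_of_indep_of_le_right (hL.indep s t hst) hV.comap_le
    exact (h1.comp hexp measurable_id).symm
  rw [hind.integral_fun_mul_eq_mul_integral (hV.mono (ℱ.le s) le_rfl).aestronglyMeasurable
    (hexp.comp hinc).aestronglyMeasurable]
  congr 1
  have hst' : (fun ω => L (s + (t - s)) ω - L s ω) = fun ω => L t ω - L s ω := by
    rw [add_tsub_cancel_of_le hst]
  have hlaw := (hL.stationary s (t - s)).map_eq
  rw [hst'] at hlaw
  rw [charFun_apply, ← hlaw, integral_map hinc.aemeasurable hexp.aestronglyMeasurable]

/-- The previous identity with `V = exp (i ⟪L s, ξ⟫)`. -/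
theorem IsLevyProcess.charFun_add (hL : IsLevyProcess ℱ L P) (s t : ℝ≥0) (ξ : E) :
    charFun (P.map (L (s + t))) ξ = charFun (P.map (L s)) ξ * charFun (P.map (L t)) ξ := by
  have hexp : Measurable fun x : E => Complex.exp ((⟪x, ξ⟫ : ℝ) * Complex.I) := by fun_prop
  have h := hL.integral_mul_exp_increment (le_self_add : s ≤ s + t)
    (hexp.comp (hL.adapted s)) ξ
  rw [add_tsub_cancel_left] at h
  rw [charFun_apply, charFun_apply (μ := P.map (L s)),
    integral_map (hL.measurable _).aemeasurable hexp.aestronglyMeasurable,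
    integral_map (hL.measurable _).aemeasurable hexp.aestronglyMeasurable]
  refine Eq.trans (integral_congr_ae (ae_of_all _ fun ω => ?_)) h
  simp only [Function.comp_apply]
  rw [← Complex.exp_add, ← add_mul, ← Complex.ofReal_add, ← inner_add_left, add_sub_cancel]

set_option linter.unusedSectionVars false in
theorem IsAlphaStable.charFun_eq [IsProbabilityMeasure P] {α : ℝ} (hα : 0 < α)
    (hL : IsLevyProcess ℱ L P)
    (hs : IsAlphaStable α L P) (t : ℝ≥0) (ξ : E) :
    charFun (P.map (L t)) ξ = charFun (P.map (L 1)) ((t : ℝ) ^ (1 / α) • ξ) := by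
  have := Measure.isProbabilityMeasure_map (μ := P) (hL.measurable 1).aemeasurable
  -- Scaling is assumed for `t > 0` only. At `t = 0` both sides are `1`, because `L 0 = 0` almost
  -- surely and `0 ^ (1 / α) = 0`.
  rcases eq_or_ne t 0 with rfl | ht
  · have h0 : P.map (L 0) = P.map (fun _ => (0 : E)) := Measure.map_congr hL.zero
    rw [h0, Measure.map_const, NNReal.coe_zero, Real.zero_rpow (by positivity), zero_smul]
    simp
  · have ht' : 0 < t := pos_iff_ne_zero.2 ht
    have hpos : (0 : ℝ) < t := ht'
    rw [← (hs.scaling t ht').map_eq, charFun_map_smul_comp (hL.measurable t).aemeasurable,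
      smul_smul,
      ← Real.rpow_add hpos]
    simp

/-- For `c ≥ 0`, self-similarity reads `c L_1` as `L` at time `c ^ α`. Strict stability is then the
additivity of time. -/
theorem IsAlphaStable.charFun_mul [IsProbabilityMeasure P] {α : ℝ} (hα : 0 < α)
    (hL : IsLevyProcess ℱ L P)
    (hs : IsAlphaStable α L P) {a b : ℝ} (ha : 0 ≤ a) (hb : 0 ≤ b) (ξ : E) :
    charFun (P.map (L 1)) (a • ξ) * charFun (P.map (L 1)) (b • ξ) =
      charFun (P.map (L 1)) ((a ^ α + b ^ α) ^ (1 / α) • ξ) := by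
  have key : ∀ c : ℝ, 0 ≤ c → charFun (P.map (L 1)) (c • ξ) =
      charFun (P.map (L (Real.toNNReal (c ^ α)))) ξ := fun c hc => by
    rw [hs.charFun_eq hα hL (Real.toNNReal _), Real.coe_toNNReal _ (by positivity), ← Real.rpow_mul
      hc,
      mul_one_div_cancel hα.ne', Real.rpow_one]
  rw [key a ha, key b hb, ← hL.charFun_add, hs.charFun_eq hα hL,
    ← Real.toNNReal_add (by positivity) (by positivity), Real.coe_toNNReal _ (by positivity)]

/-- The joint law of the increments of a Lévy process along a partition, and of the past. -/
theorem IsLevyProcess.integral_mul_exp_sum (hL : IsLevyProcess ℱ L P) {t : ℕ → ℝ≥0}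
    (ht : Monotone t) (x : ℕ → E) {l : ℕ} {V : Ω → ℂ} (hV : Measurable[ℱ (t l)] V) {m : ℕ}
    (hlm : l ≤ m) :
    ∫ ω, V ω * Complex.exp
        ((∑ i ∈ Finset.Ico l m, ⟪L (t (i + 1)) ω - L (t i) ω, x i⟫ : ℝ) * Complex.I) ∂P =
      (∫ ω, V ω ∂P) * ∏ i ∈ Finset.Ico l m, charFun (P.map (L (t (i + 1) - t i))) (x i) := by
  induction m, hlm using Nat.le_induction with
  | base => simp
  | succ m hlm ih =>
    -- `V` times the exponentials of the earlier increments is known at time `t m` and plays the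
    -- role of the past for the last increment.
    rw [Finset.prod_Ico_succ_top hlm, ← mul_assoc, ← ih,
      ← hL.integral_mul_exp_increment (ht (Nat.le_succ m))]
    · refine integral_congr_ae (ae_of_all _ fun ω => ?_)
      simp only [Finset.sum_Ico_succ_top hlm]
      rw [mul_assoc, ← Complex.exp_add]
      push_cast
      rw [add_mul]
    · refine (hV.mono (ℱ.mono (ht hlm)) le_rfl).mul (Complex.measurable_exp.comp
        (Measurable.mul (Complex.measurable_ofReal.comp
          (Finset.measurable_sum _ fun i hi => ?_)) measurable_const))
      have him := (Finset.mem_Ico.1 hi).2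
      refine Measurable.inner ?_ measurable_const
      exact ((hL.adapted _).mono (ℱ.mono (ht him)) le_rfl).sub
        ((hL.adapted _).mono (ℱ.mono (ht him.le)) le_rfl)

end Levy

/-! ### Partitions of an interval -/

/-- The nodes are the points of `S` and the multiples of `δ` in `[a, T]`, together with the two
ends, enumerated in increasing order. -/
theorem exists_partition {a T : ℝ≥0} (haT : a ≤ T) (S : Finset ℝ≥0) {δ : ℝ≥0} (hδ : 0 < δ) :
    ∃ (N : ℕ) (t : ℕ → ℝ≥0), Monotone t ∧ t 0 = a ∧ t N = T ∧
      (∀ s ∈ S, s ∈ Icc a T → ∃ i ≤ N, t i = s) ∧ (∀ i, t (i + 1) ≤ t i + δ) ∧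
      (∀ i, ∀ s ∈ S, s ∉ Ioo (t i) (t (i + 1))) ∧ ∀ i < N, t i < t (i + 1) := by
  classical
  set G : Finset ℝ≥0 := (Finset.range (⌊T / δ⌋₊ + 1)).image fun i : ℕ => (i : ℝ≥0) * δ with hG
  set F : Finset ℝ≥0 := insert a (insert T ((S ∪ G).filter (· ∈ Icc a T))) with hF
  have hFI : ∀ s ∈ F, s ∈ Icc a T := by
    intro s hs
    simp only [hF, Finset.mem_insert, Finset.mem_filter] at hs
    rcases hs with rfl | rfl | h
    · exact ⟨le_rfl, haT⟩
    · exact ⟨haT, le_rfl⟩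
    · exact h.2
  have hcard : 0 < F.card := Finset.card_pos.2 ⟨a, by simp [hF]⟩
  -- The enumeration stays at its last value beyond index `F.card - 1`, which makes it a monotone
  -- sequence on all of `ℕ`.
  set t : ℕ → ℝ≥0 := fun i => F.orderEmbOfFin rfl ⟨min i (F.card - 1), by omega⟩ with ht
  have htF : ∀ i, t i ∈ F := fun i => F.orderEmbOfFin_mem rfl _
  have hmono : Monotone t := fun i j hij =>
    (F.orderEmbOfFin rfl).monotone (Fin.mk_le_mk.2 (min_le_min_right _ hij))
  have hhit : ∀ s ∈ F, ∃ i ≤ F.card - 1, t i = s := by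
    intro s hs
    rw [← Finset.mem_coe, ← F.range_orderEmbOfFin rfl] at hs
    obtain ⟨j, rfl⟩ := hs
    refine ⟨j, by omega, ?_⟩
    simp only [ht]
    congr 1
    ext
    simp only
    omega
  have hgap : ∀ s ∈ F, ∀ i, s ∉ Ioo (t i) (t (i + 1)) := by
    rintro s hs i ⟨h1, h2⟩
    obtain ⟨j, -, rfl⟩ := hhit s hs
    rcases le_or_gt j i with h | h
    · exact (hmono h).not_gt h1
    · exact (hmono h).not_gt h2
  have hmem : ∀ s ∈ S ∪ G, s ∈ Icc a T → s ∈ F := fun s hs hsI => by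
    simp only [hF, Finset.mem_insert, Finset.mem_filter]
    exact Or.inr (Or.inr ⟨hs, hsI⟩)
  refine ⟨F.card - 1, t, hmono, ?_, ?_, ?_, ?_, ?_, fun i hi =>
    (F.orderEmbOfFin rfl).strictMono (Fin.mk_lt_mk.2 (by omega))⟩
  · obtain ⟨j, -, hj⟩ := hhit a (by simp [hF])
    exact le_antisymm (hj ▸ hmono (Nat.zero_le j)) (hFI _ (htF 0)).1
  · obtain ⟨j, hjN, hj⟩ := hhit T (by simp [hF])
    exact le_antisymm (hFI _ (htF _)).2 (hj.symm.le.trans (hmono hjN))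
  · exact fun s hs hsI => hhit s (hmem s (Finset.mem_union_left _ hs) hsI)
  · intro i
    -- In a cell longer than `δ` the first multiple of `δ` after `t i` would be a node strictly
    -- inside the cell.
    by_contra! hlt
    have hj1 : t i < ((⌊t i / δ⌋₊ + 1 : ℕ) : ℝ≥0) * δ := by
      have := Nat.lt_floor_add_one (t i / δ)
      rw [div_lt_iff₀ hδ] at this
      exact_mod_cast this
    have hj2 : ((⌊t i / δ⌋₊ + 1 : ℕ) : ℝ≥0) * δ ≤ t i + δ := by
      have := Nat.floor_le (zero_le : 0 ≤ t i / δ)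
      rw [le_div_iff₀ hδ] at this
      push_cast
      rw [add_mul, one_mul]
      exact add_le_add_left this δ
    have hI : ((⌊t i / δ⌋₊ + 1 : ℕ) : ℝ≥0) * δ ∈ Icc a T :=
      ⟨(hFI _ (htF i)).1.trans hj1.le, (hj2.trans hlt.le).trans (hFI _ (htF _)).2⟩
    refine hgap _ (hmem _ (Finset.mem_union_right _ ?_) hI) i ⟨hj1, hj2.trans_lt hlt⟩
    rw [hG, Finset.mem_image]
    refine ⟨_, Finset.mem_range.2 (Nat.lt_succ_of_le (Nat.le_floor ?_)), rfl⟩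
    rw [le_div_iff₀ hδ]
    exact hI.2
  · intro i s hs hsI
    exact hgap s (hmem s (Finset.mem_union_left _ hs)
      ⟨(hFI _ (htF i)).1.trans hsI.1.le, hsI.2.le.trans (hFI _ (htF _)).2⟩) i hsI

theorem exists_mem_Ioc_of_partition {β : Type*} [LinearOrder β] {t : ℕ → β} {l r : ℕ}
    (hlr : l ≤ r) {s : β} (hs : s ∈ Ioc (t l) (t r)) :
    ∃ i ∈ Finset.Ico l r, s ∈ Ioc (t i) (t (i + 1)) := by
  induction r, hlr using Nat.le_induction with
  | base => exact absurd hs.1 (not_lt.2 hs.2)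
  | succ r hlr ih =>
    rcases le_or_gt s (t r) with h | h
    · obtain ⟨i, hi, hsi⟩ := ih ⟨hs.1, h⟩
      exact ⟨i, Finset.Ico_subset_Ico_right (Nat.le_succ r) hi, hsi⟩
    · exact ⟨r, by simp [hlr], h, hs.2⟩

/-- The left-continuous step function with the value `v i` on `(t i, t (i + 1)]`, `l ≤ i < r`. -/
def stepOn (t : ℕ → ℝ) (l r : ℕ) (v : ℕ → ℝ) (s : ℝ) : ℝ :=
  ∑ i ∈ Finset.Ico l r, (Ioc (t i) (t (i + 1))).indicator (fun _ => v i) s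

theorem sum_indicator_Ioc_eq {β ι : Type*} [LinearOrder β] [DecidableEq ι] [LinearOrder ι]
    {A : Finset ι}
    {x y : ι → β} (hxy : ∀ i j, i < j → y i ≤ x j) (v : ι → ℝ) {i : ι} (hi : i ∈ A) {s : β}
    (hs : s ∈ Ioc (x i) (y i)) :
    ∑ j ∈ A, (Ioc (x j) (y j)).indicator (fun _ => v j) s = v i := by
  rw [Finset.sum_eq_single_of_mem i hi, indicator_of_mem hs]
  intro j _ hji
  refine indicator_of_notMem (fun hsj => ?_) _
  rcases lt_or_gt_of_ne hji with h | h
  · exact ((hxy j i h).trans_lt hs.1).not_ge hsj.2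
  · exact ((hxy i j h).trans_lt hsj.1).not_ge hs.2

theorem stepOn_eq {t : ℕ → ℝ} (ht : Monotone t) {l r i : ℕ} (hi : i ∈ Finset.Ico l r) (v : ℕ → ℝ)
    {s : ℝ} (hs : s ∈ Ioc (t i) (t (i + 1))) : stepOn t l r v s = v i :=
  sum_indicator_Ioc_eq (fun _ _ h => ht h) v hi hs

theorem measurable_stepOn (t : ℕ → ℝ) (l r : ℕ) (v : ℕ → ℝ) : Measurable (stepOn t l r v) :=
  Finset.measurable_sum _ fun _ _ => measurable_const.indicator measurableSet_Ioc

theorem integral_stepOn_mul {t : ℕ → ℝ} (ht : Monotone t) {l r : ℕ} (hlr : l ≤ r) (v : ℕ → ℝ)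
    {h : ℝ → ℝ} (hh : Continuous h) :
    ∫ s in t l..t r, stepOn t l r v s * h s =
      ∑ i ∈ Finset.Ico l r, v i * ∫ s in t i..t (i + 1), h s := by
  have hcell : ∀ i ∈ Finset.Ico l r, EqOn (fun s => v i * h s)
      (fun s => stepOn t l r v s * h s) (uIoc (t i) (t (i + 1))) := fun i hi s hs => by
    rw [uIoc_of_le (ht (Nat.le_succ i))] at hs
    simp only [stepOn_eq ht hi v hs]
  rw [← intervalIntegral.sum_integral_adjacent_intervals_Ico hlr]
  · refine Finset.sum_congr rfl fun i hi => ?_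
    rw [← intervalIntegral.integral_const_mul]
    exact intervalIntegral.integral_congr_ae (ae_of_all _ fun s hs => (hcell i hi hs).symm)
  · intro i hi
    exact ((hh.const_mul (v i)).intervalIntegrable _ _).congr (hcell i (Finset.mem_Ico.2 hi))

/-- Riemann sums along partitions with pointwise converging values. -/
theorem tendsto_sum_mul_integral {t : ℕ → ℕ → ℝ} (ht : ∀ m, Monotone (t m)) {l r : ℕ → ℕ}
    (hlr : ∀ m, l m ≤ r m) {p q : ℝ} (hl : ∀ m, t m (l m) = p) (hr : ∀ m, t m (r m) = q)
    (v : ℕ → ℕ → ℝ) {C : ℝ} (hC : ∀ᶠ m in atTop, ∀ i ∈ Finset.Ico (l m) (r m), |v m i| ≤ C)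
    {h : ℝ → ℝ} (hh : Continuous h) {F : ℝ → ℝ}
    (hF : ∀ s ∈ Ioc p q, ∀ i : ℕ → ℕ,
      (∀ m, i m ∈ Finset.Ico (l m) (r m) ∧ s ∈ Ioc (t m (i m)) (t m (i m + 1))) →
      Tendsto (fun m => v m (i m)) atTop (𝓝 (F s))) :
    Tendsto (fun m => ∑ i ∈ Finset.Ico (l m) (r m), v m i * ∫ s in t m i..t m (i + 1), h s) atTop
      (𝓝 (∫ s in p..q, F s * h s)) := by
  have hpq : p ≤ q := by simpa [hl, hr] using ht 0 (hlr 0)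
  -- Since `h` is integrated exactly over each cell, the sum is the integral of a step function
  -- against `h`. Dominated convergence then needs only pointwise limits, and no regularity of `F`.
  have heq : ∀ m, ∑ i ∈ Finset.Ico (l m) (r m), v m i * ∫ s in t m i..t m (i + 1), h s =
      ∫ s in p..q, stepOn (t m) (l m) (r m) (v m) s * h s := fun m => by
    rw [← integral_stepOn_mul (ht m) (hlr m) (v m) hh, hl, hr]
  simp_rw [heq]
  refine intervalIntegral.tendsto_integral_filter_of_dominated_convergence (fun s => C * |h s|)
    (Eventually.of_forall fun m => ((measurable_stepOn _ _ _ _).mul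
      hh.measurable).aestronglyMeasurable) ?_
    ((continuous_const.mul hh.abs).intervalIntegrable _ _) ?_
  · filter_upwards [hC] with m hm
    refine ae_of_all _ fun s hs => ?_
    rw [uIoc_of_le hpq, ← hl m, ← hr m] at hs
    obtain ⟨i, hi, hsi⟩ := exists_mem_Ioc_of_partition (hlr m) hs
    rw [stepOn_eq (ht m) hi _ hsi, norm_mul, Real.norm_eq_abs, Real.norm_eq_abs]
    exact mul_le_mul_of_nonneg_right (hm i hi) (abs_nonneg _)
  · refine ae_of_all _ fun s hs => ?_
    rw [uIoc_of_le hpq] at hs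
    have hex : ∀ m, ∃ i, i ∈ Finset.Ico (l m) (r m) ∧ s ∈ Ioc (t m i) (t m (i + 1)) := fun m => by
      have hs' := hs
      rw [← hl m, ← hr m] at hs'
      exact exists_mem_Ioc_of_partition (hlr m) hs'
    choose i hi using hex
    refine ((hF s hs i hi).mul_const (h s)).congr fun m => ?_
    rw [stepOn_eq (ht m) (hi m).1 _ (hi m).2]

/-- Summation by parts moves the differences from a rough path `z` to a smooth weight `e`. The path
is left at the right ends of the cells, which is where right-continuity can be used. -/
theorem sum_mul_sub_eq (e z : ℕ → ℝ) {l r : ℕ} (hlr : l ≤ r) :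
    ∑ i ∈ Finset.Ico l r, e i * (z (i + 1) - z i) =
      e r * z r - e l * z l - ∑ i ∈ Finset.Ico l r, z (i + 1) * (e (i + 1) - e i) := by
  induction r, hlr using Nat.le_induction with
  | base => simp
  | succ r hlr ih => rw [Finset.sum_Ico_succ_top hlr, Finset.sum_Ico_succ_top hlr, ih]; ring

/-! ### Step functions on partitions -/

/-- The step function on `(a, b]` with the nodes `t 0, ..., t N`. -/
def StepFunction.ofSeq {a b : ℝ≥0} (N : ℕ) (t : ℕ → ℝ≥0) (ht : Monotone t) (h0 : t 0 = a)
    (hN : t N = b) (v : ℕ → ℝ) : StepFunction a b where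
  size := N
  node i := t i
  mono _ _ hij := ht hij
  first := h0
  last := hN
  value i := v i

theorem StepFunction.eval_ofSeq {a b : ℝ≥0} {N : ℕ} {t : ℕ → ℝ≥0} (ht : Monotone t) (h0 : t 0 = a)
    (hN : t N = b) (v : ℕ → ℝ) {i : ℕ} (hi : i < N) {s : ℝ≥0} (hs : s ∈ Ioc (t i) (t (i + 1))) :
    (StepFunction.ofSeq N t ht h0 hN v).eval s = v i :=
  sum_indicator_Ioc_eq (A := Finset.univ) (x := fun k : Fin N => t k)
    (y := fun k : Fin N => t (k + 1)) (fun _ _ h => ht h) (fun k => v k)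
    (Finset.mem_univ (⟨i, hi⟩ : Fin N)) hs

/-- Over the `i`-th cell every other summand of the elementary integral is constant: cells before it
are completed and cells after it have not begun. -/
theorem StepFunction.integral_ofSeq_sub {Ω : Type*} {a b : ℝ≥0} {N : ℕ} {t : ℕ → ℝ≥0}
    (ht : Monotone t) (h0 : t 0 = a) (hN : t N = b) (v : ℕ → ℝ) (Z : ℝ≥0 → Ω → ℝ) (ω : Ω) {i : ℕ}
    (hi : i < N) :
    (StepFunction.ofSeq N t ht h0 hN v).integral Z (t (i + 1)) ω -
      (StepFunction.ofSeq N t ht h0 hN v).integral Z (t i) ω =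
      v i * (Z (t (i + 1)) ω - Z (t i) ω) := by
  simp only [StepFunction.integral]
  rw [← Finset.sum_sub_distrib]
  refine (Finset.sum_eq_single (⟨i, hi⟩ : Fin N) ?_
    fun h => absurd (Finset.mem_univ _) h).trans ?_
  · intro j _ hj
    have hj' : (j : ℕ) ≠ i := fun h => hj (Fin.ext h)
    simp only [StepFunction.ofSeq, Fin.val_succ, Fin.val_castSucc]
    rcases lt_or_gt_of_ne hj' with h | h
    · rw [min_eq_left (ht (by omega : (j : ℕ) + 1 ≤ i + 1)), min_eq_left
        (ht (by omega : (j : ℕ) ≤ i + 1)),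
        min_eq_left (ht (by omega : (j : ℕ) + 1 ≤ i)), min_eq_left (ht (by omega : (j : ℕ) ≤ i))]
      ring
    · rw [min_eq_right (ht (by omega : i + 1 ≤ (j : ℕ) + 1)), min_eq_right
        (ht (by omega : i + 1 ≤ (j : ℕ))),
        min_eq_right (ht (by omega : i ≤ (j : ℕ) + 1)), min_eq_right (ht (by omega : i ≤ (j : ℕ)))]
      ring
  · simp only [StepFunction.ofSeq, Fin.val_succ, Fin.val_castSucc]
    rw [min_self, min_self, min_eq_left (ht (Nat.le_succ i)), min_eq_right (ht (Nat.le_succ i))]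
    ring

/-! ### Linear equations driven by a path -/

theorem integral_mul_exp_sub (r p q : ℝ) :
    ∫ s in p..q, r * Real.exp (r * (q - s)) = Real.exp (r * (q - p)) - 1 := by
  have h : ∀ s ∈ uIcc p q, HasDerivAt (fun s => -Real.exp (r * (q - s)))
      (r * Real.exp (r * (q - s))) s := fun s _ => by
    have := (((hasDerivAt_id s).const_sub q).const_mul r).exp.fun_neg
    simpa [mul_comm] using this
  rw [intervalIntegral.integral_eq_sub_of_hasDerivAt h
    (Continuous.intervalIntegrable (by fun_prop) _ _)]
  simp; ring

/-- Variation of constants for `dX = (r X + b) dt + dZ`. -/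
theorem linear_equation_solution {r p q : ℝ} (hpq : p ≤ q) {X Z b : ℝ → ℝ}
    (hX : IntervalIntegrable X volume p q) (hb : IntervalIntegrable b volume p q)
    (heq : ∀ t ∈ Icc p q, X t = X p + (Z t - Z p) + ∫ s in p..t, (r * X s + b s)) :
    X q - Real.exp (r * (q - p)) * X p - ∫ s in p..q, b s * Real.exp (r * (q - s)) =
      Z q - Real.exp (r * (q - p)) * Z p + ∫ s in p..q, Z s * (r * Real.exp (r * (q - s))) := by
  set h : ℝ → ℝ := fun s => r * X s + b s with hh
  have hhint : IntervalIntegrable h volume p q := (hX.const_mul r).add hb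
  set J : ℝ → ℝ := fun t => ∫ s in p..t, h s with hJ
  have hp : p ∈ uIcc p q := left_mem_uIcc
  have hJac : AbsolutelyContinuousOnInterval J p q :=
    hhint.absolutelyContinuousOnInterval_intervalIntegral hp
  -- Integration by parts is applied to the absolutely continuous pair `e`, `J`. The right-hand side
  -- of the theorem is `∫ e dZ` after the same integration by parts, so `Z` itself needs no bounded
  -- variation.
  set e : ℝ → ℝ := fun s => Real.exp (r * (q - s)) with he
  have hec : Continuous e := by fun_prop
  have heac : AbsolutelyContinuousOnInterval e p q :=
    ContDiffOn.absolutelyContinuousOnInterval (by fun_prop)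
  have hed : ∀ s, HasDerivAt e (-(r * e s)) s := fun s => by
    have := (((hasDerivAt_id s).const_sub q).const_mul r).exp
    simpa [mul_comm] using this
  have hparts := heac.integral_deriv_mul_eq_sub hJac
  have hcongr : ∫ s in p..q, deriv e s * J s + e s * deriv J s =
      ∫ s in p..q, (Z s * (r * e s) + (X p - Z p) * (r * e s) + b s * e s) := by
    refine intervalIntegral.integral_congr_ae ?_
    filter_upwards [hhint.ae_hasDerivAt_integral] with s hs hspq
    have hs' := uIoc_subset_uIcc hspq
    rw [(hed s).deriv, (hs hs' p hp).deriv]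
    -- Substituting this makes the terms in `r * X s` cancel, leaving only `Z`, `b` and constants.
    have hJs : J s = X s - X p - (Z s - Z p) := by
      rw [uIcc_of_le hpq] at hs'
      simp only [hJ, heq s hs']; ring
    rw [hJs]
    simp only [hh]; ring
  have hZint : IntervalIntegrable Z volume p q := by
    have h1 : IntervalIntegrable (fun s => X s - J s - (X p - Z p)) volume p q :=
      (hX.sub hJac.continuousOn.intervalIntegrable).sub intervalIntegrable_const
    refine h1.congr fun s hs => ?_
    have hs' := uIoc_subset_uIcc hs
    rw [uIcc_of_le hpq] at hs'
    simp only [hJ]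
    rw [heq s hs']; ring
  have hre : Continuous fun s => r * e s := by fun_prop
  rw [hcongr, intervalIntegral.integral_add ((hZint.mul_continuousOn hre.continuousOn).add
      ((hre.const_mul _).intervalIntegrable _ _)) (hb.mul_continuousOn hec.continuousOn),
    intervalIntegral.integral_add (hZint.mul_continuousOn hre.continuousOn)
      ((hre.const_mul _).intervalIntegrable _ _), intervalIntegral.integral_const_mul,
    integral_mul_exp_sub] at hparts
  have hJp : J p = 0 := by simp [hJ]
  have hJq : J q = X q - X p - (Z q - Z p) := by
    simp only [hJ, heq q (right_mem_Icc.2 hpq)]; ring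
  have heq' : e q = 1 := by simp [he]
  rw [hJp, hJq, heq'] at hparts
  linear_combination -hparts

/-- Riemann-Stieltjes sums of a convergent sequence of paths. -/
theorem tendsto_sum_exp_mul_increment (r : ℝ) {t : ℕ → ℕ → ℝ} (ht : ∀ m, Monotone (t m))
    {l k : ℕ → ℕ} (hlk : ∀ m, l m ≤ k m) {p q : ℝ} (hl : ∀ m, t m (l m) = p)
    (hk : ∀ m, t m (k m) = q) (hmesh : ∀ ε > 0, ∀ᶠ m in atTop, ∀ i, t m (i + 1) ≤ t m i + ε)
    {Z : ℝ → ℝ} {Zm : ℕ → ℝ → ℝ} (hunif : TendstoUniformlyOn Zm Z atTop (Icc p q)) {C : ℝ}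
    (hC : ∀ s ∈ Icc p q, |Z s| ≤ C) (hrc : ∀ s ∈ Icc p q, ContinuousWithinAt Z (Icc s q) s) :
    Tendsto (fun m => ∑ i ∈ Finset.Ico (l m) (k m),
      Real.exp (r * (q - t m i)) * (Zm m (t m (i + 1)) - Zm m (t m i))) atTop
      (𝓝 (Z q - Real.exp (r * (q - p)) * Z p +
        ∫ s in p..q, Z s * (r * Real.exp (r * (q - s))))) := by
  have hpq : p ≤ q := by simpa [hl, hk] using ht 0 (hlk 0)
  have hsub : ∀ m i, i ∈ Finset.Ico (l m) (k m) → p ≤ t m i ∧ t m (i + 1) ≤ q := fun m i hi => by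
    rw [Finset.mem_Ico] at hi
    exact ⟨(hl m).symm.le.trans (ht m hi.1), (ht m hi.2).trans (hk m).le⟩
  have hre : Continuous fun s => r * Real.exp (r * (q - s)) := by fun_prop
  -- Increments of the exponential weight are integrals of `-r * e`, so the sum left by summation by
  -- parts has the form treated in `tendsto_sum_mul_integral`.
  have hinc : ∀ x y, Real.exp (r * (q - y)) - Real.exp (r * (q - x)) =
      -∫ s in x..y, r * Real.exp (r * (q - s)) := fun x y => by
    have := intervalIntegral.integral_add_adjacent_intervals
      (hre.intervalIntegrable (μ := volume) x y) (hre.intervalIntegrable y q)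
    rw [integral_mul_exp_sub, integral_mul_exp_sub] at this
    linarith
  have hlim := tendsto_sum_mul_integral ht hlk hl hk (fun m i => Zm m (t m (i + 1))) (C := C + 1)
    ?_ hre (F := Z) ?_
  · have hZ : ∀ s ∈ Icc p q, Tendsto (fun m => Zm m s) atTop (𝓝 (Z s)) :=
      fun s hs => hunif.tendsto_at hs
    refine (((hZ q (right_mem_Icc.2 hpq)).sub ((hZ p (left_mem_Icc.2 hpq)).const_mul
      (Real.exp (r * (q - p))))).add hlim).congr fun m => ?_
    rw [sum_mul_sub_eq (fun i => Real.exp (r * (q - t m i))) (fun i => Zm m (t m i)) (hlk m)]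
    simp only [hl, hk, sub_self, mul_zero, Real.exp_zero, one_mul, hinc, mul_neg,
      Finset.sum_neg_distrib, sub_neg_eq_add]
  · filter_upwards [Metric.tendstoUniformlyOn_iff.1 hunif 1 one_pos] with m hm i hi
    have hI := hsub m i hi
    have hmem : t m (i + 1) ∈ Icc p q := ⟨hI.1.trans (ht m (Nat.le_succ i)), hI.2⟩
    have h1 := hm _ hmem
    have h2 := hC _ hmem
    rw [Real.dist_eq] at h1
    rw [abs_lt] at h1
    rw [abs_le] at h2 ⊢
    constructor <;> linarith
  · intro s hs i hi
    have hsI : s ∈ Icc p q := Ioc_subset_Icc_self hs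
    -- The right ends of the cells containing `s` approach `s` from the right, the side on which `Z`
    -- is continuous.
    have hto : Tendsto (fun m => t m (i m + 1)) atTop (𝓝[Icc s q] s) := by
      refine tendsto_nhdsWithin_iff.2 ⟨?_, Eventually.of_forall fun m =>
        ⟨(hi m).2.2, (hsub m _ (hi m).1).2⟩⟩
      rw [Metric.tendsto_nhds]
      intro ε hε
      filter_upwards [hmesh (ε / 2) (half_pos hε)] with m hm
      have h1 := (hi m).2.1
      have h2 := (hi m).2.2
      have h3 := hm (i m)
      rw [Real.dist_eq, abs_lt]
      constructor <;> linarith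
    have hZs := (hrc s hsI).tendsto.comp hto
    rw [Metric.tendsto_nhds] at hZs ⊢
    intro ε hε
    filter_upwards [hZs (ε / 2) (half_pos hε),
      Metric.tendstoUniformlyOn_iff.1 hunif (ε / 2) (half_pos hε)] with m h1 h2
    have h3 := h2 (t m (i m + 1)) ⟨hsI.1.trans (hi m).2.2, (hsub m _ (hi m).1).2⟩
    calc dist (Zm m (t m (i m + 1))) (Z s)
        ≤ dist (Zm m (t m (i m + 1))) (Z (t m (i m + 1))) + dist (Z (t m (i m + 1))) (Z s) :=
          dist_triangle _ _ _
      _ < ε / 2 + ε / 2 := add_lt_add (by rwa [dist_comm]) h1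
      _ = ε := add_halves ε

/-- Near each time the path is bounded on the right by right-continuity and on the left by the left
limit; compactness of `[0, T]` makes the bound global. -/
theorem exists_norm_le_of_cadlag {F : Type*} [NormedAddCommGroup F] {f : ℝ≥0 → F}
    (hf : ∀ t : ℝ≥0, ContinuousWithinAt f (Ici t) t ∧ ∃ l : F, Tendsto f (𝓝[<] t) (𝓝 l))
    (T : ℝ≥0) : ∃ C, ∀ s ∈ Icc 0 T, ‖f s‖ ≤ C := by
  refine isCompact_Icc.induction_on (p := fun A => ∃ C, ∀ s ∈ A, ‖f s‖ ≤ C) ⟨0, by simp⟩ ?_ ?_ ?_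
  · rintro A B hAB ⟨C, hC⟩
    exact ⟨C, fun s hs => hC s (hAB hs)⟩
  · rintro A B ⟨C, hC⟩ ⟨D, hD⟩
    refine ⟨max C D, fun s hs => ?_⟩
    rcases hs with hs | hs
    · exact (hC s hs).trans (le_max_left _ _)
    · exact (hD s hs).trans (le_max_right _ _)
  · intro t _
    obtain ⟨hr, y, hy⟩ := hf t
    have h1 : ∀ᶠ s in 𝓝[≥] t, ‖f s‖ ≤ ‖f t‖ + 1 :=
      (hr.norm.tendsto.eventually_lt_const (lt_add_one _)).mono fun _ h => h.le
    have h2 : ∀ᶠ s in 𝓝[<] t, ‖f s‖ ≤ ‖y‖ + 1 :=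
      (hy.norm.eventually_lt_const (lt_add_one _)).mono fun _ h => h.le
    refine ⟨{s | ‖f s‖ ≤ max (‖f t‖ + 1) (‖y‖ + 1)}, mem_nhdsWithin_of_mem_nhds ?_,
      _, fun s hs => hs⟩
    rw [← nhdsLT_sup_nhdsGE]
    exact mem_sup.2 ⟨h2.mono fun _ h => h.trans (le_max_right _ _),
      h1.mono fun _ h => h.trans (le_max_left _ _)⟩

/-! ### Piecewise continuous functions -/

/-- On each `(grid k, grid (k + 1)]`, `y` extends continuously to the closed interval. -/
def IsPiecewiseContinuous {N : ℕ} {F : Type*} [TopologicalSpace F] (grid : Fin (N + 1) → ℝ≥0)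
    (y : ℝ≥0 → F) : Prop :=
  ∀ k : Fin N, ∃ g : ℝ≥0 → F, ContinuousOn g (Icc (grid k.castSucc) (grid k.succ)) ∧
    EqOn y g (Ioc (grid k.castSucc) (grid k.succ))

section PiecewiseContinuous

variable {N : ℕ} {grid : Fin (N + 1) → ℝ≥0} {T : ℝ≥0}

theorem IsGrid.exists_cell (hg : IsGrid T grid) {s : ℝ≥0} (hs : s ∈ Ioc 0 T) :
    ∃ k : Fin N, s ∈ Ioc (grid k.castSucc) (grid k.succ) := by
  have h0 : grid ⟨min 0 N, by omega⟩ = 0 := by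
    rw [← hg.first]; congr 1
  have hN : grid ⟨min N N, by omega⟩ = T := by
    rw [← hg.last]; congr 1; ext; simp
  obtain ⟨i, hi, hsi⟩ := exists_mem_Ioc_of_partition
    (t := fun i : ℕ => grid ⟨min i N, by omega⟩) (l := 0) (r := N) (Nat.zero_le N) (s := s)
    (by rw [h0, hN]; exact hs)
  have hiN := (Finset.mem_Ico.1 hi).2
  refine ⟨⟨i, hiN⟩, ?_⟩
  have h1 : min i N = i := min_eq_left hiN.le
  have h2 : min (i + 1) N = i + 1 := min_eq_left hiN
  simp only [h1, h2] at hsi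
  exact hsi

theorem IsGrid.le (hg : IsGrid T grid) (k : Fin (N + 1)) : grid k ≤ T :=
  hg.last ▸ hg.strictMono.monotone (Fin.le_last k)

theorem ContinuousOn.isPiecewiseContinuous {F : Type*} [TopologicalSpace F] (hg : IsGrid T grid)
    {y : ℝ≥0 → F} (hy : ContinuousOn y (Icc 0 T)) : IsPiecewiseContinuous grid y := fun _ =>
  ⟨y, hy.mono (Icc_subset_Icc zero_le (hg.le _)), fun _ _ => rfl⟩

theorem IsControl.isPiecewiseContinuous {d : ℕ} {M : ℝ} {u : ℝ≥0 → Fin d → ℝ}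
    (hu : IsControl M grid u) : IsPiecewiseContinuous grid u := fun k => by
  obtain ⟨v, hv⟩ := hu.const k
  exact ⟨fun _ => v, continuousOn_const, hv⟩

namespace IsPiecewiseContinuous

variable {F G H : Type*}

theorem comp₂ [TopologicalSpace F] [TopologicalSpace G] [TopologicalSpace H] {y : ℝ≥0 → F}
    {z : ℝ≥0 → G} (hy : IsPiecewiseContinuous grid y) (hz : IsPiecewiseContinuous grid z)
    {φ : F → G → H} (hφ : Continuous (Function.uncurry φ)) :
    IsPiecewiseContinuous grid fun s => φ (y s) (z s) := fun k => by
  obtain ⟨g, hg, hyg⟩ := hy k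
  obtain ⟨g', hg', hzg⟩ := hz k
  refine ⟨fun s => φ (g s) (g' s), hφ.comp_continuousOn (hg.prodMk hg'), fun s hs => ?_⟩
  simp only [hyg hs, hzg hs]

theorem comp [TopologicalSpace F] [TopologicalSpace G] {y : ℝ≥0 → F}
    (hy : IsPiecewiseContinuous grid y) {φ : F → G} (hφ : Continuous φ) :
    IsPiecewiseContinuous grid fun s => φ (y s) :=
  hy.comp₂ hy (φ := fun x _ => φ x) (hφ.comp continuous_fst)

theorem exists_bound [SeminormedAddCommGroup F] (hg : IsGrid T grid) {y : ℝ≥0 → F}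
    (hy : IsPiecewiseContinuous grid y) : ∃ C, ∀ s ∈ Ioc 0 T, ‖y s‖ ≤ C := by
  have : ∀ k : Fin N, ∃ C, ∀ s ∈ Ioc (grid k.castSucc) (grid k.succ), ‖y s‖ ≤ C := fun k => by
    obtain ⟨g, hgc, hyg⟩ := hy k
    obtain ⟨C, hC⟩ := isCompact_Icc.exists_bound_of_continuousOn hgc
    exact ⟨C, fun s hs => hyg hs ▸ hC s (Ioc_subset_Icc_self hs)⟩
  choose C hC using this
  refine ⟨∑ k, |C k|, fun s hs => ?_⟩
  obtain ⟨k, hk⟩ := hg.exists_cell hs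
  exact ((hC k s hk).trans (le_abs_self _)).trans
    (Finset.single_le_sum (f := fun k => |C k|) (fun _ _ => abs_nonneg _) (Finset.mem_univ k))

/-- Uniform continuity on each closed cell, with one `δ` for finitely many cells. The grid points
are excluded from `Ico s s'` and not from `Ioo s s'`, because a jump may occur immediately after a
grid point. -/
theorem exists_modulus [PseudoMetricSpace F] (hg : IsGrid T grid) {y : ℝ≥0 → F}
    (hy : IsPiecewiseContinuous grid y) {ε : ℝ} (hε : 0 < ε) :
    ∃ δ > 0, ∀ s ∈ Ioc 0 T, ∀ s', s ≤ s' → s' ≤ T → dist s s' < δ →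
      (∀ k, grid k ∉ Ico s s') → dist (y s) (y s') < ε := by
  have : ∀ k : Fin N, ∀ᶠ δ : ℝ in 𝓝[>] 0, ∀ s ∈ Ioc (grid k.castSucc) (grid k.succ),
      ∀ s' ∈ Ioc (grid k.castSucc) (grid k.succ), dist s s' < δ → dist (y s) (y s') < ε := by
    intro k
    obtain ⟨g, hgc, hyg⟩ := hy k
    obtain ⟨δ, hδ, h⟩ := Metric.uniformContinuousOn_iff.1
      (isCompact_Icc.uniformContinuousOn_of_continuous hgc) ε hε
    filter_upwards [Ioo_mem_nhdsGT hδ] with δ' hδ' s hs s' hs' hd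
    rw [hyg hs, hyg hs']
    exact h s (Ioc_subset_Icc_self hs) s' (Ioc_subset_Icc_self hs') (hd.trans hδ'.2)
  obtain ⟨δ, hδ, hpos⟩ := ((eventually_all.2 this).and self_mem_nhdsWithin).exists
  refine ⟨δ, hpos, fun s hs s' hss' hs'T hd hgap => ?_⟩
  obtain ⟨k, hk⟩ := hg.exists_cell hs
  refine hδ k s hk s' ⟨hk.1.trans_le hss', ?_⟩ hd
  by_contra! hlt
  exact hgap _ ⟨hk.2, hlt⟩

theorem aestronglyMeasurable [NormedAddCommGroup F] [SecondCountableTopology F]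
    (hg : IsGrid T grid) {y : ℝ≥0 → F} (hy : IsPiecewiseContinuous grid y) :
    AEStronglyMeasurable (fun s : ℝ => y s.toNNReal) (volume.restrict (Ioc (0 : ℝ) T)) := by
  have hsub : Ioc (0 : ℝ) T ⊆ ⋃ k : Fin N, Ioc (grid k.castSucc : ℝ) (grid k.succ) := by
    intro s hs
    obtain ⟨k, hk⟩ := hg.exists_cell (s := s.toNNReal) ⟨Real.toNNReal_pos.2 hs.1,
      Real.toNNReal_le_iff_le_coe.2 hs.2⟩
    refine mem_iUnion.2 ⟨k, ?_⟩
    have h1 := NNReal.coe_lt_coe.2 hk.1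
    have h2 := NNReal.coe_le_coe.2 hk.2
    rw [Real.coe_toNNReal _ hs.1.le] at h1 h2
    exact ⟨h1, h2⟩
  refine AEStronglyMeasurable.mono_set hsub (aestronglyMeasurable_iUnion_iff.2 fun k => ?_)
  obtain ⟨g, hgc, hyg⟩ := hy k
  have hmem : ∀ s ∈ Ioc (grid k.castSucc : ℝ) (grid k.succ),
      s.toNNReal ∈ Ioc (grid k.castSucc) (grid k.succ) := fun s hs =>
    ⟨Real.lt_toNNReal_iff_coe_lt.2 hs.1, Real.toNNReal_le_iff_le_coe.2 hs.2⟩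
  have hcont : ContinuousOn (fun s : ℝ => g s.toNNReal)
      (Ioc (grid k.castSucc : ℝ) (grid k.succ)) :=
    hgc.comp continuous_real_toNNReal.continuousOn fun s hs => Ioc_subset_Icc_self (hmem s hs)
  refine (hcont.aestronglyMeasurable measurableSet_Ioc).congr ?_
  filter_upwards [ae_restrict_mem measurableSet_Ioc] with s hs
  exact (hyg (hmem s hs)).symm

end IsPiecewiseContinuous

end PiecewiseContinuous

/-! ### Almost sure approximation of the wealth process -/

namespace IsPiecewiseContinuous

variable {N : ℕ} {grid : Fin (N + 1) → ℝ≥0} {T : ℝ≥0} {F : Type*} [NormedAddCommGroup F]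
  [SecondCountableTopology F]

theorem memLp (hg : IsGrid T grid) {y : ℝ≥0 → F} (hy : IsPiecewiseContinuous grid y) (p q : ℝ≥0)
    (hq : q ≤ T) (β : ℝ≥0∞) :
    MemLp (fun s : ℝ => y s.toNNReal) β (volume.restrict (Ioc (p : ℝ) q)) := by
  obtain ⟨C, hC⟩ := hy.exists_bound hg
  have hsub : Ioc (p : ℝ) q ⊆ Ioc (0 : ℝ) T := Ioc_subset_Ioc p.2 (NNReal.coe_le_coe.2 hq)
  refine MemLp.of_bound ((hy.aestronglyMeasurable hg).mono_set hsub) C ?_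
  filter_upwards [ae_restrict_mem measurableSet_Ioc] with s hs
  exact hC _ ⟨Real.toNNReal_pos.2 (hsub hs).1, Real.toNNReal_le_iff_le_coe.2 (hsub hs).2⟩

theorem intervalIntegrable (hg : IsGrid T grid) {y : ℝ≥0 → F} (hy : IsPiecewiseContinuous grid y)
    {p q : ℝ≥0} (hpq : p ≤ q) (hq : q ≤ T) :
    IntervalIntegrable (fun s : ℝ => y s.toNNReal) volume p q := by
  rw [intervalIntegrable_iff_integrableOn_Ioc_of_le (NNReal.coe_le_coe.2 hpq)]
  exact (hy.memLp hg p q hq 1).integrable le_rfl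

end IsPiecewiseContinuous

theorem StepFunction.continuousWithinAt_integral {Ω : Type*} {a b : ℝ≥0} (φ : StepFunction a b)
    {Z : ℝ≥0 → Ω → ℝ} {ω : Ω} (hZ : ∀ t, ContinuousWithinAt (fun s => Z s ω) (Ici t) t) (t : ℝ≥0) :
    ContinuousWithinAt (fun s => φ.integral Z s ω) (Ici t) t := by
  have h : ∀ c, ContinuousWithinAt (fun s => Z (min c s) ω) (Ici t) t := fun c =>
    (hZ (min c t)).comp (f := fun s => min c s) (by fun_prop) fun s hs => min_le_min_left c hs
  simp only [StepFunction.integral]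
  exact tendsto_finsetSum _ fun k _ => (((h _).sub (h _)).const_mul _)

theorem StepFunction.exists_bound_integral {Ω : Type*} {a b : ℝ≥0} (φ : StepFunction a b)
    {Z : ℝ≥0 → Ω → ℝ} {ω : Ω} {C : ℝ} (hC : ∀ s ∈ Icc 0 b, |Z s ω| ≤ C) :
    ∃ D, ∀ s ∈ Icc a b, |φ.integral Z s ω| ≤ D := by
  refine ⟨∑ k, |φ.value k| * (C + C), fun s hs => ?_⟩
  simp only [StepFunction.integral]
  refine (Finset.abs_sum_le_sum_abs _ _).trans (Finset.sum_le_sum fun k _ => ?_)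
  rw [abs_mul]
  refine mul_le_mul_of_nonneg_left ((abs_sub _ _).trans (add_le_add ?_ ?_)) (abs_nonneg _)
  · exact hC _ ⟨zero_le, (min_le_right _ _).trans hs.2⟩
  · exact hC _ ⟨zero_le, (min_le_right _ _).trans hs.2⟩

/-- A sequence that converges uniformly in probability has a subsequence that converges uniformly
almost surely. -/
theorem exists_subseq_tendstoUniformlyOn {Ω ι : Type*} [Fintype ι] {mΩ : MeasurableSpace Ω}
    {P : Measure Ω} {a b : ℝ≥0} {Y : ι → ℕ → ℝ≥0 → Ω → ℝ} {I : ι → ℝ≥0 → Ω → ℝ}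
    (h : ∀ i, TendstoUCP P a b (Y i) (I i)) :
    ∃ ns : ℕ → ℕ, StrictMono ns ∧ ∀ᵐ ω ∂P, ∀ i,
      TendstoUniformlyOn (fun m t => Y i (ns m) t ω) (fun t => I i t ω) atTop (Icc a b) := by
  -- Borel-Cantelli: at stage `l` the index is chosen so that the probability of an error of at
  -- least `2 ^ (-l)` is at most `2 ^ (-l)`. Subadditivity of outer measure suffices, so the
  -- exceptional sets need not be measurable.
  set A : ℕ → ℕ → Set Ω := fun l m =>
    {ω | ∃ i, ∃ t ∈ Icc a b, (1 / 2 : ℝ) ^ l ≤ |Y i m t ω - I i t ω|} with hA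
  have hA0 : ∀ l, Tendsto (fun m => P (A l m)) atTop (𝓝 0) := fun l => by
    have h0 : Tendsto (fun m => ∑ i, P {ω | ∃ t ∈ Icc a b, (1 / 2 : ℝ) ^ l ≤
        |Y i m t ω - I i t ω|}) atTop (𝓝 0) := by
      simpa using tendsto_finsetSum Finset.univ fun i _ => h i ((1 / 2 : ℝ) ^ l) (by positivity)
    refine tendsto_of_tendsto_of_tendsto_of_le_of_le tendsto_const_nhds h0 (fun _ => zero_le)
      fun m => ?_
    have : A l m = ⋃ i, {ω | ∃ t ∈ Icc a b, (1 / 2 : ℝ) ^ l ≤ |Y i m t ω - I i t ω|} := by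
      ext ω; simp [hA]
    rw [this]
    exact measure_iUnion_fintype_le P _
  obtain ⟨ns, hns, hle⟩ := extraction_forall_of_eventually' (P := fun l m =>
      P (A l m) ≤ (1 / 2 : ℝ≥0∞) ^ l) fun l => by
    obtain ⟨m, hm⟩ := eventually_atTop.1 ((hA0 l).eventually_le_const
      (ENNReal.pow_pos (by simp) l : (0 : ℝ≥0∞) < (1 / 2 : ℝ≥0∞) ^ l))
    exact ⟨m, hm⟩
  refine ⟨ns, hns, ?_⟩
  have hsum : ∑' l, P (A l (ns l)) ≠ ∞ := by
    refine ne_top_of_le_ne_top ?_ (ENNReal.tsum_le_tsum hle)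
    rw [ENNReal.tsum_geometric]
    simp
  have hbc := measure_setOfPred_frequently_eq_zero (p := fun l ω => ω ∈ A l (ns l)) hsum
  have hae : ∀ᵐ ω ∂P, ¬ ∃ᶠ l in atTop, ω ∈ A l (ns l) := by
    rw [ae_iff]
    simpa only [not_not] using hbc
  filter_upwards [hae] with ω hω i
  rw [not_frequently] at hω
  rw [Metric.tendstoUniformlyOn_iff]
  intro ε hε
  have hpow := (tendsto_pow_atTop_nhds_zero_of_lt_one (by norm_num : (0 : ℝ) ≤ 1 / 2)
    (by norm_num)).eventually_lt_const hε
  filter_upwards [hω, hpow] with l hl hlε t ht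
  rw [dist_comm, Real.dist_eq]
  by_contra! hge
  exact hl ⟨i, t, ht, hlε.le.trans hge⟩

/-! ### Piecewise continuous coefficients and refining partitions -/

section Wealth

variable {Ω : Type*} {mΩ : MeasurableSpace Ω} {P : Measure Ω} {ℱ : Filtration ℝ≥0 mΩ} {d : ℕ}
  {L : ℝ≥0 → Ω → EuclideanSpace ℝ (Fin d)} {T : ℝ≥0} {r : ℝ} {μ : ℝ≥0 → Fin d → ℝ}
  {σ : ℝ≥0 → Matrix (Fin d) (Fin d) ℝ} {N : ℕ} {grid : Fin (N + 1) → ℝ≥0} {M : ℝ}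
  {u : ℝ≥0 → Fin d → ℝ} {a : ℝ≥0} {X : ℝ≥0 → Ω → ℝ}

theorem IsControl.isPiecewiseContinuous_vol (hu : IsControl M grid u) (hgrid : IsGrid T grid)
    (hmarket : IsMarket T μ σ) : IsPiecewiseContinuous grid fun s => u s ᵥ* σ s :=
  hu.isPiecewiseContinuous.comp₂ (hmarket.continuous_vol.isPiecewiseContinuous hgrid)
    (φ := fun x y => x ᵥ* y) (by
      simp only [Function.uncurry_def]
      exact continuous_fst.matrix_vecMul continuous_snd)

theorem IsControl.isPiecewiseContinuous_entry (hu : IsControl M grid u) (hgrid : IsGrid T grid)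
    (hmarket : IsMarket T μ σ) (i j : Fin d) :
    IsPiecewiseContinuous grid fun s => u s i * σ s i j :=
  hu.isPiecewiseContinuous.comp₂ (hmarket.continuous_vol.isPiecewiseContinuous hgrid)
    (φ := fun x y => x i * y i j) (by simp only [Function.uncurry_def]; fun_prop)

theorem IsControl.isPiecewiseContinuous_drift (hu : IsControl M grid u) (hgrid : IsGrid T grid)
    (hmarket : IsMarket T μ σ) (r : ℝ) :
    IsPiecewiseContinuous grid fun s => ∑ i, u s i * (μ s i - r) :=
  hu.isPiecewiseContinuous.comp₂ (hmarket.continuous_drift.isPiecewiseContinuous hgrid)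
    (φ := fun x y => ∑ i, x i * (y i - r)) (by simp only [Function.uncurry_def]; fun_prop)

/-- Finer and finer partitions with nodes at `p ≤ q` and at the grid points of `[p, q]`. -/
structure IsPartitionSeq {N : ℕ} (grid : Fin (N + 1) → ℝ≥0) (p q : ℝ≥0) (t : ℕ → ℕ → ℝ≥0)
    (l k : ℕ → ℕ) : Prop where
  mono : ∀ m, Monotone (t m)
  le : ∀ m, l m ≤ k m
  left : ∀ m, t m (l m) = p
  right : ∀ m, t m (k m) = q
  mesh : ∀ ε : ℝ, 0 < ε → ∀ᶠ m in atTop, ∀ i, (t m (i + 1) : ℝ) ≤ t m i + ε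
  gap : ∀ m i j, grid j ∉ Ioo (t m i) (t m (i + 1))
  lt : ∀ m, ∀ i < k m, t m i < t m (i + 1)

theorem IsPartitionSeq.comp {p q : ℝ≥0} {t : ℕ → ℕ → ℝ≥0} {l k : ℕ → ℕ}
    (h : IsPartitionSeq grid p q t l k) {ns : ℕ → ℕ} (hns : StrictMono ns) :
    IsPartitionSeq grid p q (t ∘ ns) (l ∘ ns) (k ∘ ns) where
  mono _ := h.mono _
  le _ := h.le _
  left _ := h.left _
  right _ := h.right _
  mesh ε hε := hns.tendsto_atTop.eventually (h.mesh ε hε)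
  gap _ := h.gap _
  lt _ := h.lt _

/-- In the limit, the values of a piecewise continuous function at the right ends of the partition
intervals are uniformly close to the values inside the intervals. -/
theorem IsPartitionSeq.eventually_dist_lt {F : Type*} [PseudoMetricSpace F] {p q : ℝ≥0}
    {t : ℕ → ℕ → ℝ≥0} {l k : ℕ → ℕ} (h : IsPartitionSeq grid p q t l k) (hgrid : IsGrid T grid)
    {y : ℝ≥0 → F} (hy : IsPiecewiseContinuous grid y) {ε : ℝ} (hε : 0 < ε) :
    ∀ᶠ m in atTop, ∀ i, ∀ s ∈ Ioc (t m i) (t m (i + 1)), t m (i + 1) ≤ T →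
      dist (y s) (y (t m (i + 1))) < ε := by
  obtain ⟨δ, hδ, hmod⟩ := hy.exists_modulus hgrid hε
  filter_upwards [h.mesh (δ / 2) (half_pos hδ)] with m hm i s hs hT
  refine hmod s ⟨zero_le.trans_lt hs.1, hs.2.trans hT⟩ _ hs.2 hT ?_ fun j hj =>
    h.gap m i j ⟨hs.1.trans_le hj.1, hj.2⟩
  have h1 := NNReal.coe_lt_coe.2 hs.1
  have h2 := NNReal.coe_le_coe.2 hs.2
  have h3 := hm i
  rw [NNReal.dist_eq, abs_lt]
  constructor <;> linarith

/-- The partitions cover all of `[a, T]`, since the stochastic integrals are tested against step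
functions on `(a, T]`; the indices `l` and `k` cut out the part between `p` and `q`. -/
theorem exists_isPartitionSeq {N : ℕ} (grid : Fin (N + 1) → ℝ≥0) {p q : ℝ≥0} (hap : a ≤ p)
    (hpq : p ≤ q)
    (hqT : q ≤ T) :
    ∃ (n : ℕ → ℕ) (t : ℕ → ℕ → ℝ≥0) (l k : ℕ → ℕ), IsPartitionSeq grid p q t l k ∧
      (∀ m, t m 0 = a ∧ t m (n m) = T ∧ k m ≤ n m) := by
  classical
  have haT : a ≤ T := (hap.trans hpq).trans hqT
  have key : ∀ m : ℕ, ∃ (n : ℕ) (t : ℕ → ℝ≥0) (l k : ℕ), Monotone t ∧ l ≤ k ∧ t l = p ∧ t k = q ∧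
      (∀ i, t (i + 1) ≤ t i + 1 / (m + 1)) ∧ (∀ i j, grid j ∉ Ioo (t i) (t (i + 1))) ∧ t 0 = a ∧
      t n = T ∧ k ≤ n ∧ ∀ i < n, t i < t (i + 1) := by
    intro m
    obtain ⟨n, t, hmono, h0, hn, hhit, hmesh, hgap, hlt⟩ := exists_partition haT
      (Finset.univ.image grid ∪ {p, q}) (δ := 1 / ((m : ℝ≥0) + 1)) (by positivity)
    obtain ⟨l, hl, hlp⟩ := hhit p (by simp) ⟨hap, hpq.trans hqT⟩
    obtain ⟨k, hk, hkq⟩ := hhit q (by simp) ⟨hap.trans hpq, hqT⟩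
    -- An index found for `q` can precede `l` only if `p = q`, and then `t l` equals `q` as well.
    refine ⟨n, t, l, max l k, hmono, le_max_left _ _, hlp, ?_, hmesh,
      fun i j => hgap i _ (by simp), h0, hn, max_le hl hk, hlt⟩
    rcases le_total l k with h | h
    · rw [max_eq_right h, hkq]
    · rw [max_eq_left h]
      exact le_antisymm (hlp.le.trans hpq) (hkq.symm.le.trans (hmono h))
  choose n t l k hmono hle hl hk hmesh hgap h0 hn hkn hlt using key
  refine ⟨n, t, l, k, ⟨hmono, hle, hl, hk, fun ε hε => ?_, hgap,
    fun m i hi => hlt m i (hi.trans_le (hkn m))⟩, fun m => ⟨h0 m, hn m, hkn m⟩⟩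
  filter_upwards [tendsto_one_div_add_atTop_nhds_zero_nat.eventually_lt_const hε] with m hm i
  have := NNReal.coe_le_coe.2 (hmesh m i)
  push_cast at this
  linarith

end Wealth

/-! ### Pathwise representation of the wealth by Riemann sums -/

section Wealth

variable {Ω : Type*} {mΩ : MeasurableSpace Ω} {P : Measure Ω} {ℱ : Filtration ℝ≥0 mΩ} {d : ℕ}
  {L : ℝ≥0 → Ω → EuclideanSpace ℝ (Fin d)} {T : ℝ≥0} {r : ℝ} {μ : ℝ≥0 → Fin d → ℝ}
  {σ : ℝ≥0 → Matrix (Fin d) (Fin d) ℝ} {N : ℕ} {grid : Fin (N + 1) → ℝ≥0} {M : ℝ}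
  {u : ℝ≥0 → Fin d → ℝ} {a : ℝ≥0} {X : ℝ≥0 → Ω → ℝ}

/-- The wealth process up to compounding and drift, `X_q - e^{r (q - p)} X_p - ∫_p^q e^{r (q - s)}
u_s^T (μ_s - r) ds`. -/
def stochasticPart (r : ℝ) (μ : ℝ≥0 → Fin d → ℝ) (u : ℝ≥0 → Fin d → ℝ) (X : ℝ≥0 → Ω → ℝ)
    (p q : ℝ≥0) (ω : Ω) : ℝ :=
  X q ω - Real.exp (r * (q - p)) * X p ω -
    ∫ s in (p : ℝ)..q, (∑ i, u s.toNNReal i * (μ s.toNNReal i - r)) * Real.exp (r * (q - s))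

/-- The direction in which the increment of `L` over the `i`-th interval of a partition of `[p, q]`
enters the wealth at time `q`. -/
def incrementDirection (r : ℝ) (σ : ℝ≥0 → Matrix (Fin d) (Fin d) ℝ) (u : ℝ≥0 → Fin d → ℝ)
    (q : ℝ≥0) (t : ℕ → ℝ≥0) (i : ℕ) : EuclideanSpace ℝ (Fin d) :=
  -- The exponential is taken at the left end, where summation by parts puts it. The coefficients
  -- are taken at the right end, because they are left-continuous and `(t i, t (i + 1)]` contains
  -- only that end.
  WithLp.toLp 2 (Real.exp (r * (q - t i)) • (u (t (i + 1)) ᵥ* σ (t (i + 1))))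

/-- Step integrands converge uniformly, so along a subsequence the elementary integrals converge
uniformly on almost every path. Variation of constants identifies the wealth with a functional of
the limiting path, and summation by parts identifies the limit of the weighted sums with the same
functional. -/
theorem IsWealthProcess.exists_tendsto_sum (hL : IsLevyProcess ℱ L P) (hmarket : IsMarket T μ σ)
    (hgrid : IsGrid T grid) (hu : IsControl M grid u) (hX : IsWealthProcess P ℱ L r μ σ u a T X)
    {p q : ℝ≥0} (hap : a ≤ p) (hpq : p ≤ q) (hqT : q ≤ T) :
    ∃ (t : ℕ → ℕ → ℝ≥0) (l k : ℕ → ℕ), IsPartitionSeq grid p q t l k ∧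
      ∀ᵐ ω ∂P, Tendsto (fun m => ∑ i ∈ Finset.Ico (l m) (k m),
        ⟪L (t m (i + 1)) ω - L (t m i) ω, incrementDirection r σ u q (t m) i⟫) atTop
        (𝓝 (stochasticPart r μ u X p q ω)) := by
  obtain ⟨n, t, l, k, hpart, hends⟩ := exists_isPartitionSeq grid hap hpq hqT
  obtain ⟨I, hI, heq⟩ := hX.equation
  set H : Fin d → Fin d → ℝ≥0 → ℝ := fun i j s => u s i * σ s i j with hH
  set φ : Fin d → Fin d → ℕ → StepFunction a T := fun i j m =>
    StepFunction.ofSeq (n m) (t m) (hpart.mono m) (hends m).1 (hends m).2.1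
      (fun i' => H i j (t m (i' + 1))) with hφ
  have hφH : ∀ i j, TendstoUniformlyOn (fun m => (φ i j m).eval) (H i j) atTop (Ioc a T) := by
    intro i j
    rw [Metric.tendstoUniformlyOn_iff]
    intro ε hε
    filter_upwards [hpart.eventually_dist_lt hgrid
      (hu.isPiecewiseContinuous_entry hgrid hmarket i j) hε] with m hm s hs
    rw [← (hends m).1, ← (hends m).2.1] at hs
    obtain ⟨i', hi', hsi⟩ := exists_mem_Ioc_of_partition (Nat.zero_le _) hs
    have hi'n := (Finset.mem_Ico.1 hi').2
    rw [hφ, StepFunction.eval_ofSeq _ _ _ _ hi'n hsi]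
    exact hm i' s hsi ((hpart.mono m hi'n).trans (hends m).2.1.le)
  obtain ⟨ns, hns, hunif⟩ := exists_subseq_tendstoUniformlyOn
    (fun ij : Fin d × Fin d => (hI ij.1 ij.2).2 _ (hφH ij.1 ij.2))
  refine ⟨t ∘ ns, l ∘ ns, k ∘ ns, hpart.comp hns, ?_⟩
  filter_upwards [hunif, heq, hL.cadlag] with ω hω hXω hcad
  obtain ⟨hXint, hXeq⟩ := hXω
  -- the driving path and its approximations
  set Z : ℝ≥0 → ℝ := fun s => ∑ i, ∑ j, I i j s ω with hZ
  set Zm : ℕ → ℝ≥0 → ℝ := fun m s =>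
    ∑ i, ∑ j, (φ i j (ns m)).integral (fun t ω => L t ω j) s ω with hZm
  have hZu : TendstoUniformlyOn Zm Z atTop (Icc a T) := by
    rw [Metric.tendstoUniformlyOn_iff]
    intro ε hε
    -- There are `d * d` error terms; the extra `1` keeps the denominator positive and the final
    -- inequality strict.
    have hd : 0 < ε / (d * d + 1) := by positivity
    have hall : ∀ᶠ m in atTop, ∀ ij : Fin d × Fin d, ∀ s ∈ Icc a T,
        dist (I ij.1 ij.2 s ω) ((φ ij.1 ij.2 (ns m)).integral (fun t ω => L t ω ij.2) s ω) <
          ε / (d * d + 1) :=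
      eventually_all.2 fun ij => Metric.tendstoUniformlyOn_iff.1 (hω ij) _ hd
    filter_upwards [hall] with m hm s hs
    have h1 : dist (Z s) (Zm m s) ≤ ∑ _i : Fin d, ∑ _j : Fin d, ε / (d * d + 1) := by
      refine (dist_sum_sum_le _ _ _).trans (Finset.sum_le_sum fun i _ => ?_)
      exact (dist_sum_sum_le _ _ _).trans (Finset.sum_le_sum fun j _ => (hm (i, j) s hs).le)
    refine h1.trans_lt ?_
    simp only [Finset.sum_const, Finset.card_univ, Fintype.card_fin, nsmul_eq_mul]
    rw [← mul_assoc, mul_div_assoc', div_lt_iff₀ (by positivity)]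
    nlinarith
  have hLrc : ∀ (j : Fin d) (s : ℝ≥0), ContinuousWithinAt (fun t => L t ω j) (Ici s) s :=
    fun j s => (EuclideanSpace.proj (𝕜 := ℝ) j).continuous.continuousAt.comp_continuousWithinAt
      (hcad s).1
  have hZmrc : ∀ m s, ContinuousWithinAt (Zm m) (Ici s) s := fun m s =>
    tendsto_finsetSum _ fun i _ => tendsto_finsetSum _ fun j _ =>
      (φ i j (ns m)).continuousWithinAt_integral (Z := fun t ω => L t ω j) (hLrc j) s
  obtain ⟨C, hC⟩ := exists_norm_le_of_cadlag hcad T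
  -- The definition of the integral asks for no path regularity. Right-continuity, and below
  -- boundedness, are inherited from the elementary integrals through the uniform limit.
  have hZrc : ∀ s ∈ Icc a T, ContinuousWithinAt Z (Icc s T) s := by
    intro s hs
    refine continuousWithinAt_of_locally_uniform_approx_of_continuousWithinAt
      (left_mem_Icc.2 hs.2) fun V hV => ?_
    obtain ⟨m, hm⟩ := (hZu V hV).exists
    exact ⟨Icc s T, self_mem_nhdsWithin, Zm m, (hZmrc m s).mono Icc_subset_Ici_self,
      fun s' hs' => hm s' ⟨hs.1.trans hs'.1, hs'.2⟩⟩
  obtain ⟨D, hD⟩ : ∃ D, ∀ s ∈ Icc a T, |Z s| ≤ D := by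
    obtain ⟨m, hm⟩ := (Metric.tendstoUniformlyOn_iff.1 hZu 1 one_pos).exists
    have hb : ∀ i j, ∃ D, ∀ s ∈ Icc a T,
        |(φ i j (ns m)).integral (fun t ω => L t ω j) s ω| ≤ D := fun i j =>
      (φ i j (ns m)).exists_bound_integral (Z := fun t ω => L t ω j) fun s hs =>
        (PiLp.norm_apply_le (L s ω) j).trans (hC s hs)
    choose B hB using hb
    refine ⟨1 + ∑ i, ∑ j, B i j, fun s hs => ?_⟩
    have h1 : |Zm m s| ≤ ∑ i, ∑ j, B i j :=
      (Finset.abs_sum_le_sum_abs _ _).trans (Finset.sum_le_sum fun i _ =>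
        (Finset.abs_sum_le_sum_abs _ _).trans (Finset.sum_le_sum fun j _ => hB i j s hs))
    have h2 := hm s hs
    rw [Real.dist_eq] at h2
    have h3 := abs_sub_abs_le_abs_sub (Z s) (Zm m s)
    linarith
  have hpqR : (p : ℝ) ≤ q := hpq
  have hmem : ∀ s ∈ Icc (p : ℝ) q, s.toNNReal ∈ Icc a T := fun s hs =>
    ⟨hap.trans (NNReal.le_toNNReal_of_coe_le hs.1), (Real.toNNReal_le_iff_le_coe.2 hs.2).trans hqT⟩
  -- the exact solution
  have hbaT := (hu.isPiecewiseContinuous_drift hgrid hmarket r).intervalIntegrable hgrid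
    ((hap.trans hpq).trans hqT) le_rfl
  set b : ℝ → ℝ := fun s => ∑ i, u s.toNNReal i * (μ s.toNNReal i - r) with hb
  have haT : uIcc (p : ℝ) q ⊆ uIcc (a : ℝ) T := by
    rw [uIcc_of_le hpqR, uIcc_of_le (NNReal.coe_le_coe.2 ((hap.trans hpq).trans hqT))]
    exact Icc_subset_Icc hap hqT
  -- The equation started at `p` is the difference of the equations started at `a`, evaluated at `s`
  -- and at `p`.
  have hsol := linear_equation_solution (r := r) (X := fun s => X s.toNNReal ω)
    (Z := fun s => Z s.toNNReal) (b := b) hpqR (hXint.mono_set haT) (hbaT.mono_set haT) ?_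
  · rw [Real.toNNReal_coe, Real.toNNReal_coe] at hsol
    have hlim := tendsto_sum_exp_mul_increment r (t := fun m i => (t (ns m) i : ℝ))
      (fun m _ _ hij => NNReal.coe_le_coe.2 (hpart.mono _ hij)) (fun m => hpart.le (ns m))
      (p := p) (q := q) (fun m => by rw [hpart.left]) (fun m => by rw [hpart.right])
      (fun ε hε => hns.tendsto_atTop.eventually (hpart.mesh ε hε))
      (Z := fun s => Z s.toNNReal) (Zm := fun m s => Zm m s.toNNReal) ?_
      (C := D) (fun s hs => hD _ (hmem s hs)) ?_
    · rw [Real.toNNReal_coe, Real.toNNReal_coe] at hlim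
      rw [stochasticPart, hsol]
      refine hlim.congr fun m => Finset.sum_congr rfl fun i hi => ?_
      simp only [Real.toNNReal_coe, Function.comp_apply]
      have hin : i < n (ns m) := (Finset.mem_Ico.1 hi).2.trans_le (hends (ns m)).2.2
      rw [hZm]
      simp only [← Finset.sum_sub_distrib]
      simp only [hφ, StepFunction.integral_ofSeq_sub _ _ _ _ _ _ hin]
      rw [Finset.sum_comm, incrementDirection, PiLp.inner_apply, Finset.mul_sum]
      refine Finset.sum_congr rfl fun j _ => ?_
      simp only [hH, Matrix.vecMul, dotProduct, Pi.smul_apply, smul_eq_mul, PiLp.sub_apply,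
        ← Finset.sum_mul, RCLike.inner_apply, conj_trivial]
      ring
    · rw [Metric.tendstoUniformlyOn_iff] at hZu ⊢
      intro ε hε
      filter_upwards [hZu ε hε] with m hm s hs
      exact hm _ (hmem s hs)
    · intro s hs
      refine (hZrc _ (hmem s hs)).comp (f := Real.toNNReal) (by fun_prop) fun s' hs' => ?_
      exact ⟨Real.toNNReal_mono hs'.1, (hmem s' ⟨hs.1.trans hs'.1, hs'.2⟩).2⟩
  · intro s hs
    have h1 := hXeq _ (hmem s hs)
    have h2 := hXeq p ⟨hap, hpq.trans hqT⟩
    have hsub : ∀ s ∈ Icc (p : ℝ) q, uIcc (a : ℝ) s ⊆ uIcc (a : ℝ) T := fun s hs => by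
      rw [uIcc_of_le ((NNReal.coe_le_coe.2 hap).trans hs.1),
        uIcc_of_le (NNReal.coe_le_coe.2 ((hap.trans hpq).trans hqT))]
      exact Icc_subset_Icc_right (hs.2.trans hqT)
    have hint : ∀ s ∈ Icc (p : ℝ) q, IntervalIntegrable (fun s => r * X s.toNNReal ω + b s)
        volume a s := fun s hs =>
      ((hXint.const_mul r).add hbaT).mono_set (hsub s hs)
    have h3 := intervalIntegral.integral_interval_sub_left (hint s hs)
      (hint p (left_mem_Icc.2 hpqR))
    rw [Real.coe_toNNReal s (p.2.trans hs.1)] at h1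
    simp only [Real.toNNReal_coe]
    rw [h1, h2, ← h3]
    simp only [hZ, hb]
    ring

end Wealth

/-! ### The law of the stochastic part -/

/-- The law `Q` on the line is strictly `α`-stable: `a Z + b Z'` has the law of
`(a ^ α + b ^ α) ^ (1 / α) Z` for `a, b ≥ 0` and independent `Z`, `Z'` with the law `Q`. -/
def IsStrictlyStable (α : ℝ) (Q : Measure ℝ) : Prop :=
  ∀ a b η : ℝ, 0 ≤ a → 0 ≤ b →
    charFun Q (a * η) * charFun Q (b * η) = charFun Q ((a ^ α + b ^ α) ^ (1 / α) * η)

theorem IsStrictlyStable.prod_charFun {α : ℝ} (hα : 0 < α) {Q : Measure ℝ} [IsProbabilityMeasure Q]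
    (hQ : IsStrictlyStable α Q) {ι : Type*} (A : Finset ι) {β : ι → ℝ} (hβ : ∀ i ∈ A, 0 ≤ β i)
    (η : ℝ) :
    ∏ i ∈ A, charFun Q (β i * η) = charFun Q ((∑ i ∈ A, β i ^ α) ^ (1 / α) * η) := by
  classical
  induction A using Finset.induction_on with
  | empty =>
    rw [Finset.sum_empty, Real.zero_rpow (by positivity), zero_mul]
    simp
  | insert i A hi ih =>
    have hA : ∀ j ∈ A, 0 ≤ β j := fun j hj => hβ j (Finset.mem_insert_of_mem hj)
    have hS : 0 ≤ ∑ j ∈ A, β j ^ α :=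
      Finset.sum_nonneg fun j hj => Real.rpow_nonneg (hA j hj) α
    rw [Finset.prod_insert hi, Finset.sum_insert hi, ih hA,
      hQ _ _ η (hβ i (Finset.mem_insert_self i A)) (Real.rpow_nonneg hS _), ← Real.rpow_mul hS,
      one_div_mul_cancel hα.ne', Real.rpow_one]

/-- On the closed cone `K` the linear functionals of `L 1` have the law `Q` up to the factor `w`. -/
structure IsWeight {Ω E : Type*} {mΩ : MeasurableSpace Ω} [NormedAddCommGroup E]
    [InnerProductSpace ℝ E] [MeasurableSpace E] (L : ℝ≥0 → Ω → E) (P : Measure Ω) (Q : Measure ℝ)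
    (K : Set E) (w : E → ℝ) : Prop where
  isClosed : IsClosed K
  smul_mem : ∀ c : ℝ, 0 ≤ c → ∀ ξ ∈ K, c • ξ ∈ K
  continuousOn : ContinuousOn w K
  nonneg : ∀ ξ ∈ K, 0 ≤ w ξ
  charFun_eq : ∀ ξ ∈ K, ∀ η : ℝ, charFun (P.map (L 1)) (η • ξ) = charFun Q (w ξ * η)

section Wealth

variable {Ω : Type*} {mΩ : MeasurableSpace Ω} {P : Measure Ω}
  {ℱ : Filtration ℝ≥0 mΩ} {d : ℕ}
  {L : ℝ≥0 → Ω → EuclideanSpace ℝ (Fin d)} {T : ℝ≥0} {r : ℝ} {μ : ℝ≥0 → Fin d → ℝ}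
  {σ : ℝ≥0 → Matrix (Fin d) (Fin d) ℝ} {N : ℕ} {grid : Fin (N + 1) → ℝ≥0} {M : ℝ}
  {u : ℝ≥0 → Fin d → ℝ} {a : ℝ≥0} {X : ℝ≥0 → Ω → ℝ}

/-- The direction in which `L` drives the wealth at time `q`. -/
def direction (r : ℝ) (σ : ℝ≥0 → Matrix (Fin d) (Fin d) ℝ) (u : ℝ≥0 → Fin d → ℝ)
    (q s : ℝ≥0) : EuclideanSpace ℝ (Fin d) :=
  WithLp.toLp 2 (Real.exp (r * (q - s)) • (u s ᵥ* σ s))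

theorem norm_toLp_exp_smul_le (r : ℝ) {q s : ℝ≥0} (hs : s ≤ q) (y : Fin d → ℝ) :
    ‖(WithLp.toLp 2 (Real.exp (r * (q - s)) • y) : EuclideanSpace ℝ (Fin d))‖ ≤
      Real.exp (|r| * q) * ‖(WithLp.toLp 2 y : EuclideanSpace ℝ (Fin d))‖ := by
  rw [WithLp.toLp_smul, norm_smul, Real.norm_eq_abs, Real.abs_exp]
  refine mul_le_mul_of_nonneg_right (Real.exp_le_exp.2 ?_) (norm_nonneg _)
  have h1 : (s : ℝ) ≤ q := hs
  have h2 : (0 : ℝ) ≤ s := s.2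
  calc r * ((q : ℝ) - s) ≤ |r| * ((q : ℝ) - s) :=
        mul_le_mul_of_nonneg_right (le_abs_self r) (by linarith)
    _ ≤ |r| * q := mul_le_mul_of_nonneg_left (by linarith) (abs_nonneg r)

/-- Convergence of the Riemann sums of the weights. -/
theorem IsPartitionSeq.tendsto_sum_weight {α : ℝ} (hα : 0 < α) {Q : Measure ℝ}
    {K : Set (EuclideanSpace ℝ (Fin d))} {w : EuclideanSpace ℝ (Fin d) → ℝ}
    (hw : IsWeight L P Q K w) (hmarket : IsMarket T μ σ) (hgrid : IsGrid T grid)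
    (hu : IsControl M grid u) (hK : ∀ s ∈ Ioc 0 T, WithLp.toLp 2 (u s ᵥ* σ s) ∈ K)
    {p q : ℝ≥0} (hqT : q ≤ T) {t : ℕ → ℕ → ℝ≥0} {l k : ℕ → ℕ}
    (h : IsPartitionSeq grid p q t l k) :
    Tendsto (fun m => ∑ i ∈ Finset.Ico (l m) (k m),
        w (incrementDirection r σ u q (t m) i) ^ α * (t m (i + 1) - t m i : ℝ)) atTop
      (𝓝 (∫ s in (p : ℝ)..q, w (direction r σ u q s.toNNReal) ^ α)) := by
  have hy := (hu.isPiecewiseContinuous_vol hgrid hmarket).comp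
    (φ := fun x => (WithLp.toLp 2 x : EuclideanSpace ℝ (Fin d))) (PiLp.continuous_toLp 2 _)
  obtain ⟨C, hC⟩ := hy.exists_bound hgrid
  have hsub : ∀ m, ∀ i ∈ Finset.Ico (l m) (k m), t m i ≤ q ∧ t m (i + 1) ∈ Ioc 0 T :=
    fun m i hi => by
      have hik := (Finset.mem_Ico.1 hi).2
      have h1 : t m (i + 1) ≤ q := (h.mono m hik).trans (h.right m).le
      exact ⟨(h.mono m (Nat.le_succ i)).trans h1, zero_le.trans_lt (h.lt m i hik), h1.trans hqT⟩
  have hxK : ∀ m, ∀ i ∈ Finset.Ico (l m) (k m), incrementDirection r σ u q (t m) i ∈ K :=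
    fun m i hi => by
      rw [incrementDirection, WithLp.toLp_smul]
      exact hw.smul_mem _ (Real.exp_pos _).le _ (hK _ (hsub m i hi).2)
  -- All sampled directions lie in this compact set, on which `w` is bounded; this supplies the
  -- dominating constant `D ^ α`.
  have hCK : IsCompact (K ∩ Metric.closedBall 0 (Real.exp (|r| * q) * C)) :=
    (isCompact_closedBall _ _).inter_left hw.isClosed
  obtain ⟨D, hD⟩ := hCK.exists_bound_of_continuousOn (hw.continuousOn.mono inter_subset_left)
  have hlim := tendsto_sum_mul_integral (t := fun m i => (t m i : ℝ))
    (fun m _ _ hij => NNReal.coe_le_coe.2 (h.mono m hij)) h.le (p := p) (q := q)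
    (fun m => by rw [h.left]) (fun m => by rw [h.right])
    (fun m i => w (incrementDirection r σ u q (t m) i) ^ α) (C := D ^ α) ?_
    (h := fun _ => 1) continuous_const
    (F := fun s => w (direction r σ u q s.toNNReal) ^ α) ?_
  · simpa using hlim
  · refine Eventually.of_forall fun m i hi => ?_
    have h0 := hw.nonneg _ (hxK m i hi)
    rw [abs_of_nonneg (Real.rpow_nonneg h0 _)]
    refine Real.rpow_le_rpow h0 ?_ hα.le
    refine (le_abs_self _).trans (hD _ ⟨hxK m i hi, ?_⟩)
    rw [mem_closedBall_zero_iff]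
    exact (norm_toLp_exp_smul_le r (hsub m i hi).1 _).trans
      (mul_le_mul_of_nonneg_left (hC _ (hsub m i hi).2) (Real.exp_pos _).le)
  · intro s hs i hi
    have hs0 : 0 < s := p.2.trans_lt hs.1
    have hmem : ∀ m, s.toNNReal ∈ Ioc (t m (i m)) (t m (i m + 1)) := fun m =>
      ⟨Real.lt_toNNReal_iff_coe_lt.2 (hi m).2.1, Real.toNNReal_le_iff_le_coe.2 (hi m).2.2⟩
    have hsT : s.toNNReal ∈ Ioc 0 T := ⟨Real.toNNReal_pos.2 hs0,
      (Real.toNNReal_le_iff_le_coe.2 hs.2).trans hqT⟩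
    have hdK : direction r σ u q s.toNNReal ∈ K := by
      rw [direction, WithLp.toLp_smul]
      exact hw.smul_mem _ (Real.exp_pos _).le _ (hK _ hsT)
    have ht : Tendsto (fun m => (t m (i m) : ℝ)) atTop (𝓝 (s.toNNReal : ℝ)) := by
      rw [Metric.tendsto_nhds]
      intro ε hε
      filter_upwards [h.mesh (ε / 2) (half_pos hε)] with m hm
      have h1 := (hi m).2.1
      have h2 := (hi m).2.2
      have h3 := hm (i m)
      rw [Real.coe_toNNReal _ hs0.le, Real.dist_eq, abs_lt]
      constructor <;> linarith
    -- The coefficients are only piecewise continuous, but no grid point lies inside a cell, so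
    -- their values at `s` and at the right end of its cell are close.
    have hyt : Tendsto (fun m => (WithLp.toLp 2 (u (t m (i m + 1)) ᵥ* σ (t m (i m + 1))) :
        EuclideanSpace ℝ (Fin d))) atTop (𝓝 (WithLp.toLp 2 (u s.toNNReal ᵥ* σ s.toNNReal))) := by
      rw [Metric.tendsto_nhds]
      intro ε hε
      filter_upwards [h.eventually_dist_lt hgrid hy hε] with m hm
      rw [dist_comm]
      exact hm (i m) _ (hmem m) (hsub m _ (hi m).1).2.2
    have hx : Tendsto (fun m => incrementDirection r σ u q (t m) (i m)) atTop
        (𝓝[K] (direction r σ u q s.toNNReal)) := by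
      refine tendsto_nhdsWithin_iff.2 ⟨?_, Eventually.of_forall fun m => hxK m _ (hi m).1⟩
      simp only [incrementDirection, direction, WithLp.toLp_smul]
      exact (Real.continuous_exp.continuousAt.tendsto.comp
        ((tendsto_const_nhds.sub ht).const_mul r)).smul hyt
    exact ((hw.continuousOn _ hdK).tendsto.comp hx).rpow_const (Or.inr hα.le)

/-- The `L^α` norm of the weights over `(p, q]`. -/
def totalWeight (α r : ℝ) (σ : ℝ≥0 → Matrix (Fin d) (Fin d) ℝ) (u : ℝ≥0 → Fin d → ℝ)
    (w : EuclideanSpace ℝ (Fin d) → ℝ) (p q : ℝ≥0) : ℝ :=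
  (∫ s in (p : ℝ)..q, w (direction r σ u q s.toNNReal) ^ α) ^ (1 / α)

/-- The formula holds for the approximating sums by factorisation, self-similarity and strict
stability. Both sides pass to the limit, the left by dominated convergence and the right by
continuity of `charFun Q`. -/
theorem IsWealthProcess.integral_mul_exp_stochasticPart [IsProbabilityMeasure P] {α : ℝ}
    (hα : 0 < α) {Q : Measure ℝ}
    [IsProbabilityMeasure Q] (hQ : IsStrictlyStable α Q)
    {K : Set (EuclideanSpace ℝ (Fin d))} {w : EuclideanSpace ℝ (Fin d) → ℝ}
    (hw : IsWeight L P Q K w) (hL : IsLevyProcess ℱ L P) (hLα : IsAlphaStable α L P)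
    (hmarket : IsMarket T μ σ) (hgrid : IsGrid T grid)
    (hu : IsControl M grid u) (hK : ∀ s ∈ Ioc 0 T, WithLp.toLp 2 (u s ᵥ* σ s) ∈ K)
    (hX : IsWealthProcess P ℱ L r μ σ u a T X)
    {p q : ℝ≥0} (hap : a ≤ p) (hpq : p ≤ q) (hqT : q ≤ T) {V : Ω → ℂ} (hV : Measurable[ℱ p] V)
    {B : ℝ} (hB : ∀ ω, ‖V ω‖ ≤ B) (η : ℝ) :
    ∫ ω, V ω * Complex.exp ((η * stochasticPart r μ u X p q ω : ℝ) * Complex.I) ∂P =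
      (∫ ω, V ω ∂P) * charFun Q (totalWeight α r σ u w p q * η) := by
  obtain ⟨t, l, k, hpart, hlim⟩ := hX.exists_tendsto_sum hL hmarket hgrid hu hap hpq hqT
  set x : ℕ → ℕ → EuclideanSpace ℝ (Fin d) := fun m => incrementDirection r σ u q (t m) with hx
  have hxK : ∀ m, ∀ i ∈ Finset.Ico (l m) (k m), x m i ∈ K := fun m i hi => by
    have hik := (Finset.mem_Ico.1 hi).2
    simp only [hx]
    rw [incrementDirection, WithLp.toLp_smul]
    exact hw.smul_mem _ (Real.exp_pos _).le _ (hK _ ⟨zero_le.trans_lt (hpart.lt m i hik),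
      ((hpart.mono m hik).trans (hpart.right m).le).trans hqT⟩)
  have hstep : ∀ m, ∫ ω, V ω * Complex.exp ((η * ∑ i ∈ Finset.Ico (l m) (k m),
        ⟪L (t m (i + 1)) ω - L (t m i) ω, x m i⟫ : ℝ) * Complex.I) ∂P =
      (∫ ω, V ω ∂P) * charFun Q ((∑ i ∈ Finset.Ico (l m) (k m),
        w (x m i) ^ α * (t m (i + 1) - t m i : ℝ)) ^ (1 / α) * η) := by
    intro m
    have h1 := hL.integral_mul_exp_sum (hpart.mono m) (fun i => η • x m i) (l := l m)
      (by rw [hpart.left]; exact hV) (hpart.le m)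
    simp only [inner_smul_right, ← Finset.mul_sum] at h1
    rw [h1]
    congr 1
    have h2 : ∀ i ∈ Finset.Ico (l m) (k m), charFun (P.map (L (t m (i + 1) - t m i))) (η • x m i) =
        charFun Q ((t m (i + 1) - t m i : ℝ) ^ (1 / α) * w (x m i) * η) := fun i hi => by
      rw [hLα.charFun_eq hα hL, NNReal.coe_sub (hpart.mono m (Nat.le_succ i)), smul_smul,
        hw.charFun_eq _ (hxK m i hi)]
      congr 1; ring
    have hnn : ∀ i, (0 : ℝ) ≤ t m (i + 1) - t m i := fun i =>
      sub_nonneg.2 (NNReal.coe_le_coe.2 (hpart.mono m (Nat.le_succ i)))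
    rw [Finset.prod_congr rfl h2, hQ.prod_charFun hα _ fun i hi =>
      mul_nonneg (Real.rpow_nonneg (hnn i) _) (hw.nonneg _ (hxK m i hi))]
    congr 3
    refine Finset.sum_congr rfl fun i hi => ?_
    -- The `α`-th power undoes the exponent `1 / α` of self-similarity, leaving the cell length as
    -- the Riemann weight.
    rw [Real.mul_rpow (Real.rpow_nonneg (hnn i) _) (hw.nonneg _ (hxK m i hi)),
      ← Real.rpow_mul (hnn i), one_div_mul_cancel hα.ne', Real.rpow_one, mul_comm]
  have hVm : Measurable V := hV.mono (ℱ.le p) le_rfl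
  refine tendsto_nhds_unique (f := fun m => ∫ ω, V ω * Complex.exp
    ((η * ∑ i ∈ Finset.Ico (l m) (k m),
      ⟪L (t m (i + 1)) ω - L (t m i) ω, x m i⟫ : ℝ) * Complex.I) ∂P) (l := atTop) ?_ ?_
  · refine tendsto_integral_of_dominated_convergence (fun _ => B) (fun m => ?_)
      (integrable_const B) (fun m => ae_of_all _ fun ω => ?_) ?_
    · have hsum : Measurable fun ω => ∑ i ∈ Finset.Ico (l m) (k m),
          ⟪L (t m (i + 1)) ω - L (t m i) ω, x m i⟫ :=
        Finset.measurable_sum _ fun i _ =>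
          ((hL.measurable _).sub (hL.measurable _)).inner measurable_const
      exact (hVm.mul (by fun_prop)).aestronglyMeasurable
    · rw [norm_mul, Complex.norm_exp_ofReal_mul_I, mul_one]
      exact hB ω
    · filter_upwards [hlim] with ω hω
      have hc : Continuous fun y : ℝ => V ω * Complex.exp ((η * y : ℝ) * Complex.I) := by fun_prop
      exact (hc.tendsto _).comp hω
  · simp_rw [hstep]
    have hS := hpart.tendsto_sum_weight (r := r) hα hw hmarket hgrid hu hK hqT
    have hroot := hS.rpow_const (p := 1 / α) (Or.inr (by positivity))
    exact ((continuous_charFun (μ := Q)).tendsto _ |>.comp (hroot.mul_const η)).const_mul _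

theorem IsWealthProcess.aemeasurable_stochasticPart (hX : IsWealthProcess P ℱ L r μ σ u a T X)
    {p q : ℝ≥0} (hap : a ≤ p) (hpq : p ≤ q) (hqT : q ≤ T) :
    AEMeasurable (stochasticPart r μ u X p q) P :=
  ((hX.aemeasurable q ⟨hap.trans hpq, hqT⟩).sub
    ((hX.aemeasurable p ⟨hap, hpq.trans hqT⟩).const_mul _)).sub_const _

/-- The stochastic part of the wealth over `(p, q]` is independent of the past up to `p`, and its
law is that of `Q` up to a factor. -/
theorem IsWealthProcess.map_restrict_stochasticPart [IsProbabilityMeasure P] {α : ℝ} (hα : 0 < α)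
    {Q : Measure ℝ}
    [IsProbabilityMeasure Q] (hQ : IsStrictlyStable α Q)
    {K : Set (EuclideanSpace ℝ (Fin d))} {w : EuclideanSpace ℝ (Fin d) → ℝ}
    (hw : IsWeight L P Q K w) (hL : IsLevyProcess ℱ L P) (hLα : IsAlphaStable α L P)
    (hmarket : IsMarket T μ σ) (hgrid : IsGrid T grid)
    (hu : IsControl M grid u) (hK : ∀ s ∈ Ioc 0 T, WithLp.toLp 2 (u s ᵥ* σ s) ∈ K)
    (hX : IsWealthProcess P ℱ L r μ σ u a T X)
    {p q : ℝ≥0} (hap : a ≤ p) (hpq : p ≤ q) (hqT : q ≤ T) {A : Set Ω}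
    (hA : MeasurableSet[ℱ p] A) :
    (P.restrict A).map (stochasticPart r μ u X p q) =
      P A • Q.map (fun y => totalWeight α r σ u w p q * y) := by
  have hD := hX.aemeasurable_stochasticPart hap hpq hqT
  have hA' : MeasurableSet A := ℱ.le p A hA
  have hfin : IsFiniteMeasure (P A • Q.map (fun y => totalWeight α r σ u w p q * y)) :=
    ⟨by
      rw [Measure.smul_apply, smul_eq_mul]
      exact ENNReal.mul_lt_top (measure_lt_top _ _) (measure_lt_top _ _)⟩
  refine Measure.ext_of_charFun (funext fun η => ?_)
  -- With `V` the indicator of `A`, the identity compares the characteristic functions of two finite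
  -- measures, which determine them.
  have h := hX.integral_mul_exp_stochasticPart hα hQ hw hL hLα hmarket hgrid hu hK hap hpq hqT
    (V := A.indicator fun _ => (1 : ℂ)) (measurable_const.indicator hA) (B := 1)
    (fun ω => by by_cases hω : ω ∈ A <;> simp [hω]) η
  rw [charFun_apply_real, charFun_apply_real, integral_map hD.restrict
    (by fun_prop), integral_smul_measure, ← charFun_apply_real, charFun_map_mul]
  have hind : ∀ ω, (A.indicator (fun _ => (1 : ℂ)) ω) *
      Complex.exp ((η * stochasticPart r μ u X p q ω : ℝ) * Complex.I) = A.indicator (fun ω =>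
        Complex.exp ((η * stochasticPart r μ u X p q ω : ℝ) * Complex.I)) ω := fun ω => by
    by_cases hω : ω ∈ A <;> simp [hω]
  simp only [hind] at h
  rw [integral_indicator hA', integral_indicator hA', setIntegral_const, Complex.real_smul,
    mul_one] at h
  rw [Complex.real_smul, ← measureReal_def, ← h]
  refine integral_congr_ae (ae_of_all _ fun ω => ?_)
  simp only [Complex.ofReal_mul]

end Wealth

/-! ### Conditional laws -/

section Conditional

variable {Ω : Type*} {m mΩ : MeasurableSpace Ω} {P : Measure Ω} [IsProbabilityMeasure P]

/-- The hypothesis on restrictions encodes both the law `η` of `Y` and its independence of `m`.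
Applied to `A = X ⁻¹' s` it gives the product formula on rectangles. -/
theorem map_prodMk_of_map_restrict {β : Type*} {mβ : MeasurableSpace β} (hm : m ≤ mΩ) {Y : Ω → ℝ}
    (hY : AEMeasurable Y P) {η : Measure ℝ} [IsProbabilityMeasure η]
    (h : ∀ A, MeasurableSet[m] A → (P.restrict A).map Y = P A • η) {X : Ω → β}
    (hX : Measurable[m] X) :
    P.map (fun ω => (X ω, Y ω)) = (P.map X).prod η := by
  have hX' : Measurable X := hX.mono hm le_rfl
  have := Measure.isProbabilityMeasure_map (μ := P) hX'.aemeasurable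
  refine (Measure.prod_eq fun s t hs ht => ?_).symm
  have hA : MeasurableSet[m] (X ⁻¹' s) := hX hs
  have h1 := congrArg (fun ν : Measure ℝ => ν t) (h _ hA)
  simp only [Measure.smul_apply, smul_eq_mul] at h1
  rw [Measure.map_apply_of_aemeasurable (hX'.aemeasurable.prodMk hY) (hs.prod ht),
    Measure.map_apply hX' hs, ← h1, Measure.map_apply_of_aemeasurable hY.restrict ht,
    Measure.restrict_apply₀' (hm _ hA).nullMeasurableSet, inter_comm]
  rfl

theorem condLaw_of_map_restrict (hm : m ≤ mΩ) {Y : Ω → ℝ} (hY : AEMeasurable Y P) {η : Measure ℝ}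
    [IsProbabilityMeasure η]
    (h : ∀ A, MeasurableSet[m] A → (P.restrict A).map Y = P A • η) :
    ∀ᵐ ω ∂P, condLaw P m Y ω = η := by
  have hid : @Measurable Ω Ω mΩ m id := fun s hs => hm s hs
  -- Conditioning on `m` is conditioning on the identity into `Ω` equipped with `m`. The joint law
  -- is a product, so its disintegration is the constant kernel `η`.
  have hprod := map_prodMk_of_map_restrict (β := Ω) (mβ := m) hm hY h
    (X := id) (@measurable_id Ω m)
  have hida : @AEMeasurable Ω Ω m mΩ id P := @Measurable.aemeasurable Ω Ω mΩ m id P hid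
  have := @Measure.isProbabilityMeasure_map Ω Ω mΩ m P _ id hida
  have hκ := @condDistrib_ae_eq_of_measure_eq_compProd Ω Ω ℝ _ _ _ mΩ P _ Y m id hY
    (@Kernel.const Ω ℝ m _ η) _ (by rw [Measure.compProd_const]; exact hprod)
  exact @ae_of_ae_map Ω Ω mΩ m P id hida _ hκ

/-- `(X, W)` is the image of the product law of `(X, Y)` under the shear `(x, y) ↦ (x, y + x * e)`,
so the kernel at `x` is `η` translated by `x * e`, which the final map undoes. An almost everywhere
equal `m`-measurable version of `X` is enough. -/
theorem condDistrib_of_map_restrict (hm : m ≤ mΩ) {Y X X' W : Ω → ℝ} (hY : AEMeasurable Y P)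
    {η : Measure ℝ}
    [IsProbabilityMeasure η] (h : ∀ A, MeasurableSet[m] A → (P.restrict A).map Y = P A • η)
    (hX' : Measurable[m] X') (hXX' : X =ᵐ[P] X') {e : ℝ} (hW : ∀ ω, W ω = Y ω + X ω * e) :
    ∀ᵐ x ∂(P.map X), (condDistrib W X P x).map (fun y => y - x * e) = η := by
  have hX'm : Measurable X' := hX'.mono hm le_rfl
  have hXm : AEMeasurable X P := ⟨X', hX'm, hXX'⟩
  have hprod : P.map (fun ω => (X ω, Y ω)) = (P.map X).prod η := by
    rw [Measure.map_congr hXX', ← map_prodMk_of_map_restrict hm hY h hX']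
    refine Measure.map_congr ?_
    filter_upwards [hXX'] with ω hω
    rw [hω]
  have := Measure.isProbabilityMeasure_map (μ := P) hXm
  set g : ℝ × ℝ → ℝ := fun z => z.2 + z.1 * e with hg
  have hgm : Measurable g := by fun_prop
  set κ : Kernel ℝ ℝ := (Kernel.id ×ₖ Kernel.const ℝ η).map g with hκ
  have hκx : ∀ x, κ x = η.map (fun y => y + x * e) := fun x => by
    rw [hκ, Kernel.map_apply _ hgm, Kernel.prod_apply, Kernel.id_apply, Kernel.const_apply,
      Measure.dirac_prod, Measure.map_map hgm (by fun_prop)]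
    rfl
  have hker : IsMarkovKernel κ := Kernel.IsMarkovKernel.map _ hgm
  have hWm : AEMeasurable W P := by
    rw [funext hW]
    exact hY.add (hXm.mul_const e)
  have hG : Measurable fun z : ℝ × ℝ => (z.1, g z) := by fun_prop
  have heq : P.map (fun ω => (X ω, W ω)) = P.map X ⊗ₘ κ := by
    have h1 : P.map (fun ω => (X ω, W ω)) =
        (P.map (fun ω => (X ω, Y ω))).map (fun z => (z.1, g z)) := by
      rw [AEMeasurable.map_map_of_aemeasurable hG.aemeasurable (hXm.prodMk hY)]
      simp only [hg, hW, Function.comp_def]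
    rw [h1, hprod]
    ext s hs
    rw [Measure.map_apply hG hs, Measure.prod_apply (hG hs), Measure.compProd_apply hs]
    refine lintegral_congr fun x => ?_
    rw [hκx, Measure.map_apply (by fun_prop) (measurable_prodMk_left hs)]
    rfl
  filter_upwards [condDistrib_ae_eq_of_measure_eq_compProd X hWm heq] with x hx
  rw [hx, hκx, Measure.map_map (by fun_prop) (by fun_prop)]
  convert Measure.map_id
  ext y
  simp

end Conditional

/-! ### Conditional risk of the terminal wealth -/

theorem RiskMeasure.ofLaw_map_affine {Ω : Type*} {mΩ : MeasurableSpace Ω} {P : Measure Ω}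
    {ℱ : Filtration ℝ≥0 mΩ} {T : ℝ≥0} {α : ℝ} {kind : TranslationKind}
    (ρ : RiskMeasure P ℱ T α kind) {Q : Measure ℝ} (hQ : ρ.ofLaw Q < ⊤) {κ : ℝ} (hκ : 0 ≤ κ)
    (β : ℝ) :
    ρ.ofLaw (Q.map fun y => κ * y + β) =
      ((match kind with
        | .cashInvariant => -β
        | .shiftInvariant => 0 : ℝ) : EReal) + ρ.ofLaw Q * (κ : EReal) := by
  -- `ofLaw` takes the default value `⊤` on laws that the domain does not carry, so finiteness
  -- supplies a representative.
  obtain ⟨Z, hZ, rfl⟩ : ∃ Z ∈ ρ.dom, P.map Z = Q := by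
    by_contra hne
    rw [RiskMeasure.ofLaw, dif_neg hne] at hQ
    exact lt_irrefl _ hQ
  have hκZ := ρ.smul_mem Z hZ κ hκ
  rw [Measure.map_map (by fun_prop) (ρ.measurable Z hZ)]
  have h1 := ρ.ofLaw_map (ρ.add_const_mem _ hκZ β)
  simp only [Function.comp_def]
  rw [h1, ρ.translation _ hκZ, ρ.pos_homogeneous Z hZ κ hκ, ρ.ofLaw_map hZ]
  cases kind with
  | cashInvariant => simp only [sub_eq_add_neg, EReal.coe_neg]; rw [add_comm, mul_comm]
  | shiftInvariant => simp only [EReal.coe_zero, zero_add]; rw [mul_comm]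

section Wealth

variable {Ω : Type*} {mΩ : MeasurableSpace Ω} {P : Measure Ω}
  {ℱ : Filtration ℝ≥0 mΩ} {d : ℕ}
  {L : ℝ≥0 → Ω → EuclideanSpace ℝ (Fin d)} {T : ℝ≥0} {r : ℝ} {μ : ℝ≥0 → Fin d → ℝ}
  {σ : ℝ≥0 → Matrix (Fin d) (Fin d) ℝ} {N : ℕ} {grid : Fin (N + 1) → ℝ≥0} {M : ℝ}
  {u : ℝ≥0 → Fin d → ℝ} {a : ℝ≥0} {X : ℝ≥0 → Ω → ℝ}

/-- The wealth equation holds only almost surely, so `X n` need not be `ℱ n`-measurable itself. The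
limit of the approximating sums, which use increments up to time `n`, provides a measurable version.
-/
theorem IsWealthProcess.exists_measurable_eq (hL : IsLevyProcess ℱ L P)
    (hmarket : IsMarket T μ σ) (hgrid : IsGrid T grid) (hu : IsControl M grid u)
    (hX : IsWealthProcess P ℱ L r μ σ u a T X) {n : ℝ≥0} (han : a ≤ n) (hnT : n ≤ T) :
    ∃ g : Ω → ℝ, Measurable[ℱ n] g ∧ X n =ᵐ[P] g := by
  obtain ⟨t, l, k, hpart, hlim⟩ := hX.exists_tendsto_sum hL hmarket hgrid hu le_rfl han hnT
  set S : ℕ → Ω → ℝ := fun m ω => ∑ i ∈ Finset.Ico (l m) (k m),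
    ⟪L (t m (i + 1)) ω - L (t m i) ω, incrementDirection r σ u n (t m) i⟫ with hS
  have hSm : ∀ m, Measurable[ℱ n] (S m) := fun m =>
    Finset.measurable_sum _ fun i hi => by
      have hi1 : t m (i + 1) ≤ n :=
        (hpart.mono m (Finset.mem_Ico.1 hi).2).trans (hpart.right m).le
      have hi0 : t m i ≤ n := (hpart.mono m (Nat.le_succ i)).trans hi1
      exact (((hL.adapted _).mono (ℱ.mono hi1) le_rfl).sub
        ((hL.adapted _).mono (ℱ.mono hi0) le_rfl)).inner measurable_const
  have hlimm : Measurable[ℱ n] fun ω => limUnder atTop (S · ω) :=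
    (@StronglyMeasurable.limUnder _ _ _ (ℱ n) _ _ _ _ _ _ _ fun m =>
      (hSm m).stronglyMeasurable).measurable
  have hXa : Measurable[ℱ n] (X a) := hX.initial.mono (ℱ.mono han) le_rfl
  refine ⟨fun ω => limUnder atTop (S · ω) + Real.exp (r * (n - a)) * X a ω +
    ∫ s in (a : ℝ)..n, (∑ i, u s.toNNReal i * (μ s.toNNReal i - r)) * Real.exp (r * (n - s)),
    (hlimm.add (hXa.const_mul _)).add measurable_const, ?_⟩
  filter_upwards [hlim] with ω hω
  rw [hω.limUnder_eq, stochasticPart]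
  ring

theorem totalWeight_nonneg {α : ℝ} {Q : Measure ℝ} {K : Set (EuclideanSpace ℝ (Fin d))}
    {w : EuclideanSpace ℝ (Fin d) → ℝ} (hw : IsWeight L P Q K w)
    (hK : ∀ s ∈ Ioc 0 T, WithLp.toLp 2 (u s ᵥ* σ s) ∈ K) {p q : ℝ≥0} (hpq : p ≤ q) (hqT : q ≤ T) :
    0 ≤ totalWeight α r σ u w p q := by
  refine Real.rpow_nonneg ?_ _
  rw [intervalIntegral.integral_of_le (NNReal.coe_le_coe.2 hpq)]
  refine setIntegral_nonneg measurableSet_Ioc fun s hs => Real.rpow_nonneg (hw.nonneg _ ?_) _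
  rw [direction, WithLp.toLp_smul]
  exact hw.smul_mem _ (Real.exp_pos _).le _ (hK _ ⟨Real.toNNReal_pos.2 (p.2.trans_lt hs.1),
    (Real.toNNReal_le_iff_le_coe.2 hs.2).trans hqT⟩)

/-- The conditional risk of the terminal wealth, for any weight function. -/
theorem IsWealthProcess.conditionalRiskEq [IsProbabilityMeasure P] {α : ℝ} (hα : 0 < α)
    {Q : Measure ℝ} [IsProbabilityMeasure Q] (hQ : IsStrictlyStable α Q)
    {K : Set (EuclideanSpace ℝ (Fin d))} {w : EuclideanSpace ℝ (Fin d) → ℝ}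
    (hw : IsWeight L P Q K w) (hL : IsLevyProcess ℱ L P) (hLα : IsAlphaStable α L P)
    (hmarket : IsMarket T μ σ) (hgrid : IsGrid T grid)
    (hu : IsControl M grid u) (hK : ∀ s ∈ Ioc 0 T, WithLp.toLp 2 (u s ᵥ* σ s) ∈ K)
    (hX : IsWealthProcess P ℱ L r μ σ u a T X) {n : ℝ≥0} (han : a ≤ n) (hnT : n ≤ T)
    {kind : TranslationKind} (ρ : RiskMeasure P ℱ T α kind) (hρ : ρ.ofLaw Q < ⊤) :
    ConditionalRiskEq ρ r X n
      (riskValue kind r μ u n T (ρ.ofLaw Q) (totalWeight α r σ u w n T)) := by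
  set β : ℝ := ∫ s in (n : ℝ)..T,
    (∑ i, u s.toNNReal i * (μ s.toNNReal i - r)) * Real.exp (r * (T - s)) with hβ
  set κ := totalWeight α r σ u w n T with hκdef
  have hκ : 0 ≤ κ := totalWeight_nonneg hw hK hnT le_rfl
  set η : Measure ℝ := Q.map fun y => κ * y + β with hη
  have hηp : IsProbabilityMeasure η :=
    Measure.isProbabilityMeasure_map (by fun_prop)
  set Y : Ω → ℝ := fun ω => X T ω - X n ω * Real.exp (r * (T - n)) with hY
  have hYD : Y = fun ω => stochasticPart r μ u X n T ω + β := by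
    ext ω
    simp only [hY, stochasticPart, hβ]
    ring
  have hD := hX.aemeasurable_stochasticPart han hnT le_rfl
  have hYm : AEMeasurable Y P := hYD ▸ hD.add_const β
  -- Adding the deterministic drift `β` to the stochastic part keeps the independence from `ℱ n` and
  -- shifts the law to `η`.
  have hrestrict : ∀ A, MeasurableSet[ℱ n] A → (P.restrict A).map Y = P A • η := fun A hA => by
    have h1 := hX.map_restrict_stochasticPart hα hQ hw hL hLα hmarket hgrid hu hK han hnT le_rfl hA
    have h2 : (P.restrict A).map Y =
        ((P.restrict A).map (stochasticPart r μ u X n T)).map (fun y => y + β) := by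
      rw [AEMeasurable.map_map_of_aemeasurable (by fun_prop) hD.restrict, hYD]
      rfl
    rw [h2, h1, Measure.map_smul, Measure.map_map (by fun_prop) (by fun_prop)]
    rfl
  have hvalue : ρ.ofLaw η = riskValue kind r μ u n T (ρ.ofLaw Q) κ := by
    rw [hη, ρ.ofLaw_map_affine hρ hκ, riskValue]
    congr 2
    cases kind with
    | cashInvariant =>
      simp only [driftTerm, hβ]
      congr 1
      refine intervalIntegral.integral_congr fun s hs => ?_
      rw [uIcc_of_le (NNReal.coe_le_coe.2 hnT)] at hs
      simp only [Real.coe_toNNReal s (n.2.trans hs.1)]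
    | shiftInvariant => simp [driftTerm]
  obtain ⟨g, hg, hXg⟩ := hX.exists_measurable_eq hL hmarket hgrid hu han hnT
  refine ⟨?_, ?_⟩
  · filter_upwards [condLaw_of_map_restrict (ℱ.le n) hYm hrestrict] with ω hω
    rw [hω, hvalue]
  · filter_upwards [condDistrib_of_map_restrict (ℱ.le n) hYm hrestrict hg hXg (W := X T)
      (e := Real.exp (r * (T - n))) (fun ω => by simp only [hY]; ring)] with x hx
    rw [hx, hvalue]

end Wealth

/-! ### Norms of the weights -/

section Norms

variable {Ω : Type*} {mΩ : MeasurableSpace Ω} {P : Measure Ω} {d : ℕ}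
  {L : ℝ≥0 → Ω → EuclideanSpace ℝ (Fin d)} {T : ℝ≥0} {r : ℝ} {μ : ℝ≥0 → Fin d → ℝ}
  {σ : ℝ≥0 → Matrix (Fin d) (Fin d) ℝ} {N : ℕ} {grid : Fin (N + 1) → ℝ≥0} {M : ℝ}
  {u : ℝ≥0 → Fin d → ℝ}

theorem IsControl.isPiecewiseContinuous_direction (hu : IsControl M grid u) (hgrid : IsGrid T grid)
    (hmarket : IsMarket T μ σ) (r : ℝ) (q : ℝ≥0) :
    IsPiecewiseContinuous grid (direction r σ u q) :=
  (hu.isPiecewiseContinuous_vol hgrid hmarket).comp₂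
    (ContinuousOn.isPiecewiseContinuous hgrid
      (y := fun s : ℝ≥0 => Real.exp (r * (q - s))) (by fun_prop))
    (φ := fun x c => (WithLp.toLp 2 (c • x) : EuclideanSpace ℝ (Fin d)))
    ((PiLp.continuous_toLp 2 _).comp (continuous_snd.smul continuous_fst))

theorem intervalIntegrable_driftTerm (hmarket : IsMarket T μ σ) (hgrid : IsGrid T grid)
    (hu : IsControl M grid u) (kind : TranslationKind) (r : ℝ) {n : ℝ≥0} (hnT : n ≤ T) :
    IntervalIntegrable (fun s : ℝ => driftTerm kind r T μ u s.toNNReal) volume n T := by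
  cases kind with
  | cashInvariant =>
    refine IsPiecewiseContinuous.intervalIntegrable hgrid
      (y := fun s => (∑ i, u s i * (μ s i - r)) * Real.exp (r * (T - s))) ?_ hnT le_rfl
    exact (hu.isPiecewiseContinuous_drift hgrid hmarket r).comp₂
      (ContinuousOn.isPiecewiseContinuous hgrid
        (y := fun s : ℝ≥0 => Real.exp (r * (T - s))) (by fun_prop))
      (φ := fun x c => x * c) (by simp only [Function.uncurry_def]; fun_prop)
  | shiftInvariant => simp [driftTerm]

theorem memLp_weight (hmarket : IsMarket T μ σ) (hgrid : IsGrid T grid) (hu : IsControl M grid u)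
    {w : EuclideanSpace ℝ (Fin d) → ℝ} (hw : Continuous w) {f : ℝ≥0 → ℝ} {n : ℝ≥0}
    (hf : ∀ s ∈ Ioc 0 T, f s = w (direction r σ u T s)) (β : ℝ≥0∞) :
    MemLp (fun s : ℝ => f s.toNNReal) β (volume.restrict (Ioc (n : ℝ) T)) := by
  refine (((hu.isPiecewiseContinuous_direction hgrid hmarket r T).comp hw).memLp hgrid n T le_rfl
    β).ae_eq ?_
  filter_upwards [ae_restrict_mem measurableSet_Ioc] with s hs
  exact (hf _ ⟨Real.toNNReal_pos.2 (n.2.trans_lt hs.1), Real.toNNReal_le_iff_le_coe.2 hs.2⟩).symm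

/-- Nonnegativity of `f` enters because `totalWeight` integrates powers of `w` itself, while the
norm uses absolute values. -/
theorem totalWeight_eq_lpNorm (hmarket : IsMarket T μ σ) (hgrid : IsGrid T grid)
    (hu : IsControl M grid u) {w : EuclideanSpace ℝ (Fin d) → ℝ} (hw : Continuous w)
    {f : ℝ≥0 → ℝ} {n : ℝ≥0} (hnT : n ≤ T) (hf : ∀ s ∈ Ioc 0 T, f s = w (direction r σ u T s))
    (hf0 : ∀ s ∈ Ioc 0 T, 0 ≤ f s) {α : ℝ} (hα : 0 < α) :
    totalWeight α r σ u w n T =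
      lpNorm (fun s : ℝ => f s.toNNReal) (ENNReal.ofReal α) (volume.restrict (Ioc (n : ℝ) T)) := by
  rw [lpNorm_eq_integral_norm_rpow_toReal (by simpa using hα) ENNReal.ofReal_ne_top
    (memLp_weight hmarket hgrid hu hw hf 1).aestronglyMeasurable, ENNReal.toReal_ofReal hα.le,
    totalWeight, one_div, intervalIntegral.integral_of_le (NNReal.coe_le_coe.2 hnT)]
  congr 1
  refine setIntegral_congr_fun measurableSet_Ioc fun s hs => ?_
  have hs' : s.toNNReal ∈ Ioc 0 T :=
    ⟨Real.toNNReal_pos.2 (n.2.trans_lt hs.1), Real.toNNReal_le_iff_le_coe.2 hs.2⟩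
  simp only [← hf _ hs', Real.norm_eq_abs, abs_of_nonneg (hf0 _ hs')]

end Norms

/-! ### One asset, no short selling -/

section Coordinate

variable {Ω : Type*} {mΩ : MeasurableSpace Ω} {P : Measure Ω} {d : ℕ} {ℱ : Filtration ℝ≥0 mΩ}
  {L : ℝ≥0 → Ω → EuclideanSpace ℝ (Fin d)}

theorem charFun_map_coordinate (hL : IsLevyProcess ℱ L P) (j : Fin d) (η : ℝ) :
    charFun (P.map fun ω => L 1 ω j) η =
      charFun (P.map (L 1)) (η • EuclideanSpace.single j (1 : ℝ)) := by
  have hLm := hL.measurable 1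
  have hj : Measurable fun ω => L 1 ω j := (EuclideanSpace.proj (𝕜 := ℝ) j).measurable.comp hLm
  rw [charFun_apply_real, charFun_apply, integral_map hj.aemeasurable (by fun_prop),
    integral_map hLm.aemeasurable (by fun_prop)]
  refine integral_congr_ae (ae_of_all _ fun ω => ?_)
  simp [inner_smul_right, EuclideanSpace.inner_single_right]

theorem IsAlphaStable.isStrictlyStable_coordinate [IsProbabilityMeasure P] {α : ℝ} (hα : 0 < α)
    (hL : IsLevyProcess ℱ L P) (hLα : IsAlphaStable α L P) (j : Fin d) :
    IsStrictlyStable α (P.map fun ω => L 1 ω j) := by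
  intro a b η ha hb
  simp only [charFun_map_coordinate hL, mul_smul]
  exact hLα.charFun_mul hα hL ha hb _

/-- The law of `L 1` may be skewed, so position and driver can be merged into a single nonnegative
scale only on the half-line. This is where the absence of short selling is used. -/
theorem isWeight_oneDim {L : ℝ≥0 → Ω → EuclideanSpace ℝ (Fin 1)} (hL : IsLevyProcess ℱ L P) :
    IsWeight L P (P.map fun ω => L 1 ω 0) {ξ | 0 ≤ ξ 0} (fun ξ => ξ 0) where
  isClosed := isClosed_le continuous_const (by fun_prop)
  smul_mem c hc ξ hξ := mul_nonneg hc hξ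
  continuousOn := by fun_prop
  nonneg _ h := h
  charFun_eq ξ _ η := by
    rw [charFun_map_coordinate hL]
    congr 1
    ext i
    fin_cases i
    simp [mul_comm]

end Coordinate

/-! ### Brownian motion -/

section Brownian

variable {Ω : Type*} {mΩ : MeasurableSpace Ω} {P : Measure Ω} {d : ℕ}
  {ℱ : Filtration ℝ≥0 mΩ} {L : ℝ≥0 → Ω → EuclideanSpace ℝ (Fin d)}

theorem HasBrownianMarginals.memLp (hL : IsLevyProcess ℱ L P) (hW : HasBrownianMarginals L P)
    (t : ℝ≥0) (j : Fin d) : MemLp (fun ω => L t ω j) 2 P := by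
  have hj : Measurable fun ω => L t ω j :=
    (EuclideanSpace.proj (𝕜 := ℝ) j).measurable.comp (hL.measurable t)
  have h := memLp_id_gaussianReal (μ := 0) (v := t) 2
  rw [← (hW t).2 j] at h
  exact (memLp_map_measure_iff (by fun_prop) hj.aemeasurable).1 h

theorem HasBrownianMarginals.variance_eq (hL : IsLevyProcess ℱ L P)
    (hW : HasBrownianMarginals L P) (t : ℝ≥0) (j : Fin d) : Var[fun ω => L t ω j; P] = t := by
  have hj : Measurable fun ω => L t ω j :=
    (EuclideanSpace.proj (𝕜 := ℝ) j).measurable.comp (hL.measurable t)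
  have h := variance_id_map (μ := P) hj.aemeasurable
  rw [(hW t).2 j, variance_id_gaussianReal] at h
  exact h.symm

theorem HasBrownianMarginals.integral_eq (hL : IsLevyProcess ℱ L P)
    (hW : HasBrownianMarginals L P) (t : ℝ≥0) (j : Fin d) : ∫ ω, L t ω j ∂P = 0 := by
  have hj : Measurable fun ω => L t ω j :=
    (EuclideanSpace.proj (𝕜 := ℝ) j).measurable.comp (hL.measurable t)
  have h := integral_map (μ := P) hj.aemeasurable (f := id) (by fun_prop)
  rw [(hW t).2 j] at h
  simpa using h.symm

theorem HasBrownianMarginals.corrMatrix_one (hL : IsLevyProcess ℱ L P)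
    (hW : HasBrownianMarginals L P) (j l : Fin d) :
    corrMatrix L P 1 j l = cov[fun ω => L 1 ω j, fun ω => L 1 ω l; P] := by
  simp [corrMatrix, hW.variance_eq hL]

/-- Scaling with `α = 2` multiplies covariances by `t`, and the product of the two standard
deviations is also `t`. -/
theorem HasBrownianMarginals.corrMatrix_eq (hL : IsLevyProcess ℱ L P)
    (hLα : IsAlphaStable 2 L P) (hW : HasBrownianMarginals L P) {t : ℝ≥0} (ht : 0 < t) :
    corrMatrix L P t = corrMatrix L P 1 := by
  have ht' : (0 : ℝ) < t := ht
  ext j l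
  rw [hW.corrMatrix_one hL]
  have hscale := hLα.scaling t ht
  have hcoord : ∀ i : Fin d, Measurable fun x : EuclideanSpace ℝ (Fin d) => x i := fun i =>
    (EuclideanSpace.proj (𝕜 := ℝ) i).measurable
  have h1 : cov[fun ω => L 1 ω j, fun ω => L 1 ω l; P] =
      cov[fun x => x j, fun x => x l; P.map (L 1)] :=
    (covariance_map_fun (hcoord j).aestronglyMeasurable (hcoord l).aestronglyMeasurable
      hscale.aemeasurable_snd).symm
  rw [h1, ← hscale.map_eq, covariance_map_fun (hcoord j).aestronglyMeasurable
    (hcoord l).aestronglyMeasurable hscale.aemeasurable_fst]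
  simp only [PiLp.smul_apply, smul_eq_mul, covariance_const_mul_left, covariance_const_mul_right]
  rw [← mul_assoc, ← Real.rpow_add ht', corrMatrix, Matrix.of_apply, hW.variance_eq hL,
    hW.variance_eq hL, Real.mul_self_sqrt ht'.le]
  norm_num [Real.rpow_neg_one]
  rw [div_eq_inv_mul]

/-- The quadratic form is the variance of the centred Gaussian variable `⟪ξ, L 1⟫`, which gives both
its sign and the characteristic function. -/
theorem HasBrownianMarginals.charFun_eq [IsProbabilityMeasure P] (hL : IsLevyProcess ℱ L P)
    (hW : HasBrownianMarginals L P) (ξ : EuclideanSpace ℝ (Fin d)) :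
    0 ≤ ξ ⬝ᵥ (corrMatrix L P 1 *ᵥ ξ) ∧ charFun (P.map (L 1)) ξ =
      Complex.exp (-((ξ ⬝ᵥ (corrMatrix L P 1 *ᵥ ξ) : ℝ) : ℂ) / 2) := by
  have hLm := hL.measurable 1
  have hg := (hW 1).1
  have hinner : ∀ ω, ⟪ξ, L 1 ω⟫ = ∑ j, ξ j * L 1 ω j := fun ω => by
    rw [PiLp.inner_apply]
    refine Finset.sum_congr rfl fun j _ => ?_
    simp [mul_comm]
  have hmean : ∫ x, ⟪ξ, x⟫ ∂(P.map (L 1)) = 0 := by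
    rw [integral_map hLm.aemeasurable (by fun_prop)]
    simp only [hinner]
    rw [integral_finsetSum _ fun j _ => ((hW.memLp hL 1 j).integrable one_le_two).const_mul _]
    simp [integral_const_mul, hW.integral_eq hL]
  have hvar : Var[fun x => ⟪ξ, x⟫; P.map (L 1)] = ξ ⬝ᵥ (corrMatrix L P 1 *ᵥ ξ) := by
    rw [variance_map (by fun_prop) hLm.aemeasurable, ← covariance_self
      ((by fun_prop : Measurable fun x => ⟪ξ, x⟫).comp hLm).aemeasurable]
    simp only [Function.comp_def, hinner]
    rw [covariance_fun_sum_fun_sum (fun j => (hW.memLp hL 1 j).const_mul _)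
      (fun j => (hW.memLp hL 1 j).const_mul _)]
    simp only [dotProduct, Matrix.mulVec, Finset.mul_sum, covariance_const_mul_left,
      covariance_const_mul_right, hW.corrMatrix_one hL]
    refine Finset.sum_congr rfl fun j _ => Finset.sum_congr rfl fun l _ => ?_
    ring
  refine ⟨hvar ▸ variance_nonneg _ _, ?_⟩
  rw [IsGaussian.charFun_eq, hvar]
  have hmean' : (∫ x, ((⟪ξ, x⟫ : ℝ) : ℂ) ∂(P.map (L 1))) = 0 := by
    rw [integral_complex_ofReal, hmean, Complex.ofReal_zero]
  congr 1
  rw [hmean']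
  simp
  ring

/-- A centred Gaussian is determined by its variance, so no sign restriction is needed and the cone
is the whole space. Any component serves as reference, since each is standard normal at time `1`. -/
theorem HasBrownianMarginals.isWeight [IsProbabilityMeasure P] (hL : IsLevyProcess ℱ L P)
    (hW : HasBrownianMarginals L P)
    (j : Fin d) : IsWeight L P (P.map fun ω => L 1 ω j) univ
      (fun ξ => √(ξ ⬝ᵥ (corrMatrix L P 1 *ᵥ ξ))) where
  isClosed := isClosed_univ
  smul_mem _ _ _ _ := mem_univ _
  continuousOn := by
    refine Continuous.continuousOn (Real.continuous_sqrt.comp ?_)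
    simp only [dotProduct, Matrix.mulVec]
    fun_prop
  nonneg _ _ := Real.sqrt_nonneg _
  charFun_eq ξ _ η := by
    obtain ⟨h0, h⟩ := hW.charFun_eq hL ξ
    rw [(hW.charFun_eq hL (η • ξ)).2, (hW 1).2 j, charFun_gaussianReal]
    have hsq : (√(ξ ⬝ᵥ (corrMatrix L P 1 *ᵥ ξ)) * η) ^ 2 =
        (η • ξ) ⬝ᵥ (corrMatrix L P 1 *ᵥ (η • ξ)) := by
      rw [mul_pow, Real.sq_sqrt h0]
      simp only [WithLp.ofLp_smul, Matrix.mulVec_smul, dotProduct_smul, smul_dotProduct,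
        smul_eq_mul]
      ring
    rw [← Complex.ofReal_pow, hsq]
    congr 1
    simp only [Complex.ofReal_zero, mul_zero, zero_mul, NNReal.coe_one, Complex.ofReal_one,
      one_mul, zero_sub, neg_div, WithLp.ofLp_smul]

end Brownian

/-! ### Symmetric stable processes -/

/-- The constant `∫_0^∞ (1 - cos w) c / w ^ (α + 1) dw`. -/
def stableConstant (α c : ℝ) : ℝ≥0∞ :=
  ∫⁻ w in Ioi (0 : ℝ), ENNReal.ofReal (c / w ^ (α + 1)) * ENNReal.ofReal (1 - Real.cos w)

/-- The substitution `y = b * w` extracts `b ^ α` from the homogeneous density; evenness of the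
cosine reduces to `b ≥ 0`. -/
theorem lintegral_one_sub_cos_mul {α c : ℝ} (hα : 0 < α) (b : ℝ) :
    ∫⁻ w in Ioi (0 : ℝ), ENNReal.ofReal (c / w ^ (α + 1)) * ENNReal.ofReal (1 - Real.cos (w * b)) =
      ENNReal.ofReal (|b| ^ α) * stableConstant α c := by
  wlog hb : 0 ≤ b generalizing b
  · rw [← abs_neg, ← this (-b) (by linarith)]
    simp only [mul_neg, Real.cos_neg]
  rcases hb.eq_or_lt with rfl | hb
  · simp [Real.zero_rpow hα.ne']
  rw [abs_of_pos hb, stableConstant]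
  have himage : (fun w => b * w) '' Ioi (0 : ℝ) = Ioi 0 := by
    rw [image_mul_left_Ioi hb, mul_zero]
  have hcov := lintegral_image_eq_lintegral_abs_deriv_mul (s := Ioi (0 : ℝ)) measurableSet_Ioi
    (f := fun w => b * w) (f' := fun _ => b)
    (fun w _ => by simpa using ((hasDerivAt_id w).const_mul b).hasDerivWithinAt)
    (mul_right_injective₀ hb.ne').injOn
    (fun y => ENNReal.ofReal (c / y ^ (α + 1)) * ENNReal.ofReal (1 - Real.cos y))
  rw [himage] at hcov
  rw [hcov, ← lintegral_const_mul' _ _ ENNReal.ofReal_ne_top]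
  refine setLIntegral_congr_fun measurableSet_Ioi fun w hw => ?_
  have hw' : 0 < w := hw
  rw [← mul_assoc, ← mul_assoc, mul_comm b w]
  congr 1
  rw [← ENNReal.ofReal_mul (by positivity), ← ENNReal.ofReal_mul (by positivity), abs_of_pos hb]
  congr 1
  rw [Real.mul_rpow hw'.le hb.le, Real.rpow_add_one hb.ne']
  have h1 : b ^ α ≠ 0 := (Real.rpow_pos_of_pos hb α).ne'
  have h2 : w ^ (α + 1) ≠ 0 := (Real.rpow_pos_of_pos hw' _).ne'
  field_simp

/-- For `|y| ≤ 1` this is the Taylor bound. For `|y| > 1` the triangle inequality gives `2 + |y|`,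
which is at most `3 * y ^ 2`. -/
theorem norm_exp_mul_I_sub_one_sub_le (y : ℝ) :
    ‖Complex.exp (Complex.I * y) - 1 - Complex.I * y‖ ≤ 3 * y ^ 2 := by
  have hn : ‖Complex.I * (y : ℂ)‖ = |y| := by simp
  rcases le_or_gt |y| 1 with h | h
  · have := Complex.norm_exp_sub_one_sub_id_le (x := Complex.I * y) (by rwa [hn])
    rw [hn, sq_abs] at this
    nlinarith [sq_nonneg y]
  · have h1 : ‖Complex.exp (Complex.I * y)‖ = 1 := by
      rw [mul_comm, Complex.norm_exp_ofReal_mul_I]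
    have h2 : ‖Complex.exp (Complex.I * y) - 1 - Complex.I * y‖ ≤ 1 + 1 + |y| := by
      refine (norm_sub_le _ _).trans (add_le_add ((norm_sub_le _ _).trans ?_) hn.le)
      rw [h1, norm_one]
    nlinarith [sq_abs y]

section Symmetric

variable {Ω E : Type*} {mΩ : MeasurableSpace Ω} [NormedAddCommGroup E] [InnerProductSpace ℝ E]
  [MeasurableSpace E] [BorelSpace E] [SecondCountableTopology E] {ℱ : Filtration ℝ≥0 mΩ}
  {L : ℝ≥0 → Ω → E} {P : Measure Ω}

/-- The compensating term is purely imaginary and disappears from the real part once integrability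
allows the real part inside the integral. -/
theorem re_integral_levyKhintchine {Λ : Measure E}
    (hΛ : ∫⁻ x, ENNReal.ofReal (min 1 (‖x‖ ^ 2)) ∂Λ < ∞) (ξ : E) :
    (∫ x, (Complex.exp (Complex.I * (⟪ξ, x⟫ : ℝ)) - 1 -
      Complex.I * (if ‖x‖ ≤ 1 then ⟪ξ, x⟫ else 0 : ℝ)) ∂Λ).re =
      -(∫⁻ x, ENNReal.ofReal (1 - Real.cos ⟪ξ, x⟫) ∂Λ).toReal := by
  set F : E → ℂ := fun x => Complex.exp (Complex.I * (⟪ξ, x⟫ : ℝ)) - 1 -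
      Complex.I * (if ‖x‖ ≤ 1 then ⟪ξ, x⟫ else 0 : ℝ) with hF
  have hm : Measurable fun x : E => (⟪ξ, x⟫ : ℝ) := by fun_prop
  have hite : Measurable fun x : E => if ‖x‖ ≤ 1 then (⟪ξ, x⟫ : ℝ) else 0 :=
    Measurable.ite (measurableSet_le (by fun_prop) measurable_const) hm measurable_const
  have hFm : Measurable F := by
    refine (Measurable.sub (Measurable.sub ?_ measurable_const) ?_)
    · exact Complex.measurable_exp.comp
        (measurable_const.mul (Complex.measurable_ofReal.comp hm))
    · exact measurable_const.mul (Complex.measurable_ofReal.comp hite)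
  -- On the unit ball the Taylor bound gives `3 * ‖ξ‖ ^ 2 * ‖x‖ ^ 2`; outside it there is no
  -- compensator and the modulus is at most `2`.
  have hbound : ∀ x, ‖F x‖ ≤ (3 * ‖ξ‖ ^ 2 + 2) * min 1 (‖x‖ ^ 2) := by
    intro x
    simp only [hF]
    split_ifs with hx
    · rw [min_eq_right (by nlinarith [norm_nonneg x])]
      refine (norm_exp_mul_I_sub_one_sub_le _).trans ?_
      have h1 : (⟪ξ, x⟫ : ℝ) ^ 2 ≤ ‖ξ‖ ^ 2 * ‖x‖ ^ 2 := by
        rw [← mul_pow, ← sq_abs]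
        exact pow_le_pow_left₀ (abs_nonneg _) (abs_real_inner_le_norm ξ x) 2
      nlinarith [sq_nonneg ‖x‖]
    · rw [min_eq_left (by nlinarith), Complex.ofReal_zero, mul_zero, sub_zero, mul_one]
      refine (norm_sub_le _ _).trans ?_
      rw [mul_comm Complex.I, Complex.norm_exp_ofReal_mul_I, norm_one]
      nlinarith [sq_nonneg ‖ξ‖]
  have hdom : Integrable (fun x : E => (3 * ‖ξ‖ ^ 2 + 2) * min 1 (‖x‖ ^ 2)) Λ := by
    refine Integrable.const_mul ⟨by fun_prop, ?_⟩ _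
    rw [hasFiniteIntegral_iff_ofReal (ae_of_all _ fun x => by positivity)]
    exact hΛ
  have hint : Integrable F Λ := hdom.mono' hFm.aestronglyMeasurable (ae_of_all _ hbound)
  have hre : ∀ x, (F x).re = -(1 - Real.cos ⟪ξ, x⟫) := fun x => by
    simp only [hF, Complex.sub_re, Complex.one_re, Complex.re_mul_ofReal, Complex.I_re, zero_mul,
      sub_zero]
    rw [mul_comm, Complex.exp_ofReal_mul_I_re]
    ring
  have h := integral_re (𝕜 := ℂ) hint
  simp only [RCLike.re_to_complex] at h
  rw [← h]
  simp only [hre]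
  rw [integral_neg, integral_eq_lintegral_of_nonneg_ae
    (ae_of_all _ fun x => by simpa using Real.cos_le_one _) (by fun_prop)]

/-- By Tonelli with the radial integral inside, each direction `v` contributes the same constant
times `|⟪ξ, v⟫| ^ α`. -/
theorem lintegral_one_sub_cos_stableLevyMeasure {α c : ℝ} (hα : 0 < α)
    (ν : Measure (Metric.sphere (0 : E) 1)) [IsProbabilityMeasure ν] (ξ : E) :
    ∫⁻ x, ENNReal.ofReal (1 - Real.cos ⟪ξ, x⟫) ∂(stableLevyMeasure α c ν) =
      stableConstant α c * ∫⁻ v, ENNReal.ofReal (|⟪ξ, (v : E)⟫| ^ α) ∂ν := by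
  have hm : Measurable fun w : ℝ => ENNReal.ofReal (c / w ^ (α + 1)) := by fun_prop
  rw [stableLevyMeasure, lintegral_map (by fun_prop) (by fun_prop),
    lintegral_prod_symm' _ (by fun_prop), ← lintegral_const_mul _ (by fun_prop)]
  refine lintegral_congr fun v => ?_
  rw [lintegral_withDensity_eq_lintegral_mul _ hm (by fun_prop)]
  simp only [Pi.mul_apply, inner_smul_right]
  rw [lintegral_one_sub_cos_mul hα, mul_comm]

/-- The characteristic function of a symmetric stable process in terms of its Lévy measure. -/
theorem IsAlphaStable.charFun_symmetric [IsProbabilityMeasure P] {α : ℝ} (hα : 0 < α) (hα2 : α < 2)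
    (hL : IsLevyProcess ℱ L P) (hLα : IsAlphaStable α L P) {c : ℝ}
    {ν : Measure (Metric.sphere (0 : E) 1)} [IsProbabilityMeasure ν]
    (hΛ : HasLevyMeasure L P (stableLevyMeasure α c ν)) (hs : IsSymmetricProcess L P) (ξ : E) :
    charFun (P.map (L 1)) ξ = Real.exp (-((stableConstant α c).toReal *
      ∫ v, |⟪ξ, (v : E)⟫| ^ α ∂ν)) := by
  obtain ⟨-, hfin, b, A, -, hψ⟩ := hΛ
  set J : E → ℝ := fun ξ => ∫ v, |⟪ξ, (v : E)⟫| ^ α ∂ν with hJ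
  set C := (stableConstant α c).toReal with hC
  -- The modulus depends only on the real part of the exponent, hence on the Gaussian and jump parts
  -- and not on the drift.
  have hnorm : ∀ (t : ℝ≥0) (ξ : E), ‖charFun (P.map (L t)) ξ‖ =
      Real.exp (t * (-(1 / 2 * ⟪A ξ, ξ⟫) - C * J ξ)) := by
    intro t ξ
    rw [hψ, Complex.norm_exp, Complex.re_ofReal_mul, Complex.add_re, Complex.sub_re,
      re_integral_levyKhintchine hfin, lintegral_one_sub_cos_stableLevyMeasure hα]
    congr 2
    rw [ENNReal.toReal_mul, hJ]
    simp only
    rw [integral_eq_lintegral_of_nonneg_ae (ae_of_all _ fun v => by positivity)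
      (Measurable.aestronglyMeasurable (by fun_prop))]
    simp
    ring
  have hsymm : ∀ (t : ℝ≥0) (ξ : E), (starRingEnd ℂ) (charFun (P.map (L t)) ξ) =
      charFun (P.map (L t)) ξ := fun t ξ => by
    rw [← charFun_neg]
    conv_rhs => rw [(hs t).map_eq]
    have h1 : (fun ω => -L t ω) = fun ω => (-1 : ℝ) • L t ω := by ext ω; simp
    rw [h1, charFun_map_smul_comp (hL.measurable t).aemeasurable]
    simp
  have hreal : ∀ (t : ℝ≥0) (ξ : E), ((charFun (P.map (L t)) ξ).re : ℂ) = charFun (P.map (L t)) ξ :=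
    fun t ξ => Complex.conj_eq_iff_re.1 (hsymm t ξ)
  -- Symmetry makes the characteristic functions real. At time `1` it is the square of the real
  -- value at time `1 / 2`, hence nonnegative and equal to its modulus.
  have hpos : charFun (P.map (L 1)) ξ = (‖charFun (P.map (L 1)) ξ‖ : ℂ) := by
    have h1 : charFun (P.map (L 1)) ξ = ((charFun (P.map (L (1 / 2))) ξ).re ^ 2 : ℝ) := by
      have h2 := hL.charFun_add (1 / 2) (1 / 2) ξ
      rw [add_halves] at h2
      rw [h2, ← hreal]
      push_cast
      rw [sq, Complex.ofReal_re]
    rw [h1, Complex.norm_real, Real.norm_of_nonneg (sq_nonneg _)]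
  -- At time `2` the jump part doubles under both descriptions. The Gaussian part is multiplied by
  -- `2` in one and by `2 ^ (2 / α)` in the other, so it vanishes for `α < 2`.
  have hA : ⟪A ξ, ξ⟫ = 0 := by
    have h1 := hnorm 2 ξ
    rw [hLα.charFun_eq hα hL, hnorm] at h1
    have h2 := Real.exp_injective h1
    have hJs : J (((2 : ℝ≥0) : ℝ) ^ (1 / α) • ξ) = 2 * J ξ := by
      simp only [hJ, inner_smul_left, abs_mul, NNReal.coe_ofNat, conj_trivial]
      rw [← integral_const_mul]
      refine integral_congr_ae (ae_of_all _ fun v => ?_)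
      simp only
      rw [Real.mul_rpow (abs_nonneg _) (abs_nonneg _), abs_of_nonneg (by positivity),
        ← Real.rpow_mul (by norm_num), one_div_mul_cancel hα.ne', Real.rpow_one]
    rw [hJs] at h2
    simp only [map_smul, inner_smul_left, inner_smul_right, NNReal.coe_ofNat, conj_trivial,
      NNReal.coe_one, one_mul] at h2
    have h3 : (2 : ℝ) < (2 : ℝ) ^ (1 / α) * (2 : ℝ) ^ (1 / α) := by
      rw [← Real.rpow_add (by norm_num)]
      conv_lhs => rw [← Real.rpow_one 2]
      refine Real.rpow_lt_rpow_of_exponent_lt (by norm_num) ?_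
      rw [← add_div, lt_div_iff₀ hα]
      linarith
    have h4 : ((2 : ℝ) ^ (1 / α) * (2 : ℝ) ^ (1 / α) - 2) * ⟪A ξ, ξ⟫ = 0 := by linarith
    exact (mul_eq_zero.1 h4).resolve_left (by linarith)
  rw [hpos, hnorm, hA]
  simp [hJ]

end Symmetric

/-! ### The symmetric weight and its norms -/

section SymmetricWeight

variable {d : ℕ}

theorem continuous_integral_abs_inner_rpow {E : Type*} [NormedAddCommGroup E]
    [InnerProductSpace ℝ E] [FiniteDimensional ℝ E] [MeasurableSpace E] [BorelSpace E] {α : ℝ}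
    (hα : 0 < α) (ν : Measure (Metric.sphere (0 : E) 1)) [IsProbabilityMeasure ν] :
    Continuous fun ξ : E => ∫ v, |⟪ξ, (v : E)⟫| ^ α ∂ν := by
  have hproper : ProperSpace E := FiniteDimensional.proper ℝ E
  have h := continuous_parametric_integral_of_continuous (μ := ν) (s := univ)
    (f := fun (ξ : E) (v : Metric.sphere (0 : E) 1) => |⟪ξ, (v : E)⟫| ^ α)
    (Continuous.rpow_const (continuous_abs.comp (continuous_fst.inner
      (continuous_subtype_val.comp continuous_snd))) fun _ => Or.inr hα.le) isCompact_univ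
  simpa using h

/-- The unit vectors of the line are `1` and `-1`, so the spherical measure of the one-dimensional
reference process has no influence on the value. -/
theorem integral_abs_inner_rpow_sphere_real {α : ℝ} (ν : Measure (Metric.sphere (0 : ℝ) 1))
    [IsProbabilityMeasure ν] (η : ℝ) :
    ∫ v, |⟪η, (v : ℝ)⟫| ^ α ∂ν = |η| ^ α := by
  have : ∀ v : Metric.sphere (0 : ℝ) 1, |⟪η, (v : ℝ)⟫| ^ α = |η| ^ α := fun v => by
    have hv : |(v : ℝ)| = 1 := norm_eq_of_mem_sphere v
    rw [RCLike.inner_apply, conj_trivial, abs_mul, hv, one_mul]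
  rw [integral_congr_ae (ae_of_all _ this)]
  simp

/-- Both characteristic functions have the form `exp (-C ∫ |⟪ξ, v⟫| ^ α)` with the same `C`, because
the Lévy measures share the constant `c`. The exponent is even, so every direction is allowed. -/
theorem isWeight_symmetric {Ω Ω' E : Type*} {mΩ : MeasurableSpace Ω} {mΩ' : MeasurableSpace Ω'}
    [NormedAddCommGroup E] [InnerProductSpace ℝ E] [FiniteDimensional ℝ E] [MeasurableSpace E]
    [BorelSpace E] {P : Measure Ω} [IsProbabilityMeasure P] {P' : Measure Ω'}
    [IsProbabilityMeasure P'] {ℱ : Filtration ℝ≥0 mΩ} {ℱ' : Filtration ℝ≥0 mΩ'} {L : ℝ≥0 → Ω → E}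
    {L' : ℝ≥0 → Ω' → ℝ} {α : ℝ} (hα : 0 < α) (hα2 : α < 2) (hL : IsLevyProcess ℱ L P)
    (hLα : IsAlphaStable α L P) (hL' : IsLevyProcess ℱ' L' P') (hLα' : IsAlphaStable α L' P')
    {c : ℝ} {ν : Measure (Metric.sphere (0 : E) 1)} [IsProbabilityMeasure ν]
    {ν' : Measure (Metric.sphere (0 : ℝ) 1)} [IsProbabilityMeasure ν']
    (hΛ : HasLevyMeasure L P (stableLevyMeasure α c ν)) (hs : IsSymmetricProcess L P)
    (hΛ' : HasLevyMeasure L' P' (stableLevyMeasure α c ν')) (hs' : IsSymmetricProcess L' P') :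
    IsWeight L P (P'.map (L' 1)) univ
      (fun ξ => (∫ v, |⟪ξ, (v : E)⟫| ^ α ∂ν) ^ (1 / α)) where
  isClosed := isClosed_univ
  smul_mem _ _ _ _ := mem_univ _
  continuousOn := ((continuous_integral_abs_inner_rpow hα ν).rpow_const
    fun _ => Or.inr (by positivity)).continuousOn
  nonneg ξ _ := Real.rpow_nonneg (integral_nonneg fun v => by positivity) _
  charFun_eq ξ _ η := by
    have h0 : 0 ≤ ∫ v, |⟪ξ, (v : E)⟫| ^ α ∂ν := integral_nonneg fun v => by positivity
    have hη : ∫ v, |⟪η • ξ, (v : E)⟫| ^ α ∂ν = |η| ^ α * ∫ v, |⟪ξ, (v : E)⟫| ^ α ∂ν := by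
      rw [← integral_const_mul]
      refine integral_congr_ae (ae_of_all _ fun v => ?_)
      simp only [real_inner_smul_left, abs_mul]
      rw [Real.mul_rpow (abs_nonneg _) (abs_nonneg _)]
    rw [hLα.charFun_symmetric hα hα2 hL hΛ hs, hη, hLα'.charFun_symmetric hα hα2 hL' hΛ' hs',
      integral_abs_inner_rpow_sphere_real, abs_mul,
      Real.mul_rpow (abs_nonneg _) (abs_nonneg _), abs_of_nonneg (Real.rpow_nonneg h0 _),
      ← Real.rpow_mul h0, one_div_mul_cancel hα.ne', Real.rpow_one, mul_comm (|η| ^ α)]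

theorem IsAlphaStable.isStrictlyStable {Ω : Type*} {mΩ : MeasurableSpace Ω} {P : Measure Ω}
    [IsProbabilityMeasure P] {ℱ : Filtration ℝ≥0 mΩ} {L : ℝ≥0 → Ω → ℝ} {α : ℝ} (hα : 0 < α)
    (hL : IsLevyProcess ℱ L P) (hLα : IsAlphaStable α L P) :
    IsStrictlyStable α (P.map (L 1)) := fun _ _ η ha hb => hLα.charFun_mul hα hL ha hb η

variable {T : ℝ≥0} {r : ℝ} {μ : ℝ≥0 → Fin d → ℝ} {σ : ℝ≥0 → Matrix (Fin d) (Fin d) ℝ} {N : ℕ}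
  {grid : Fin (N + 1) → ℝ≥0} {M : ℝ} {u : ℝ≥0 → Fin d → ℝ} {n : ℝ≥0}
  {ν : Measure (Metric.sphere (0 : EuclideanSpace ℝ (Fin d)) 1)}

theorem discountedVolAlong_eq_inner (s : ℝ≥0)
    (v : Metric.sphere (0 : EuclideanSpace ℝ (Fin d)) 1) :
    discountedVolAlong r T σ u s v = ⟪direction r σ u T s, (v : EuclideanSpace ℝ (Fin d))⟫ := by
  rw [discountedVolAlong, PiLp.inner_apply]
  refine Finset.sum_congr rfl fun j _ => ?_
  simp [direction, discountedVol, mul_comm]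

theorem weightSymmetric_eq [IsProbabilityMeasure ν] {α : ℝ} (hα : 0 < α) (s : ℝ≥0) :
    weightSymmetric α r T ν σ u s =
      (∫ v, |⟪direction r σ u T s, (v : EuclideanSpace ℝ (Fin d))⟫| ^ α ∂ν) ^ (1 / α) := by
  have h : discountedVolAlong r T σ u s =
      fun v : Metric.sphere (0 : EuclideanSpace ℝ (Fin d)) 1 =>
        ⟪direction r σ u T s, (v : EuclideanSpace ℝ (Fin d))⟫ :=
    funext fun v => discountedVolAlong_eq_inner s v
  rw [weightSymmetric, h, lpNorm_eq_integral_norm_rpow_toReal (by simpa using hα)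
    ENNReal.ofReal_ne_top (Measurable.aestronglyMeasurable (by fun_prop)),
    ENNReal.toReal_ofReal hα.le, one_div]
  rfl

theorem memLp_discountedVolAlong (hmarket : IsMarket T μ σ) (hgrid : IsGrid T grid)
    (hu : IsControl M grid u) [IsProbabilityMeasure ν] (β : ℝ≥0∞) :
    MemLp (fun p : ℝ × Metric.sphere (0 : EuclideanSpace ℝ (Fin d)) 1 =>
      discountedVolAlong r T σ u p.1.toNNReal p.2) β
      ((volume.restrict (Ioc (n : ℝ) T)).prod ν) := by
  have hd := hu.isPiecewiseContinuous_direction hgrid hmarket r T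
  obtain ⟨C, hC⟩ := hd.exists_bound hgrid
  simp only [discountedVolAlong_eq_inner]
  have hm := (hd.memLp hgrid n T le_rfl 1).aestronglyMeasurable
  refine MemLp.of_bound (AEStronglyMeasurable.inner (𝕜 := ℝ) (hm.comp_fst (ν := ν))
    (Measurable.aestronglyMeasurable (by fun_prop))) C ?_
  have hae : ∀ᵐ s ∂(volume.restrict (Ioc (n : ℝ) T)), ‖direction r σ u T s.toNNReal‖ ≤ C := by
    filter_upwards [ae_restrict_mem measurableSet_Ioc] with s hs
    exact hC _ ⟨Real.toNNReal_pos.2 (n.2.trans_lt hs.1), Real.toNNReal_le_iff_le_coe.2 hs.2⟩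
  filter_upwards [Measure.quasiMeasurePreserving_fst.ae hae] with p hp
  refine (norm_inner_le_norm _ _).trans ?_
  rwa [norm_eq_of_mem_sphere, mul_one]

/-- Fubini: the inner integral over the sphere is the `α`-th power of the weight. -/
theorem totalWeight_eq_lpNorm_prod (hmarket : IsMarket T μ σ) (hgrid : IsGrid T grid)
    (hu : IsControl M grid u) [IsProbabilityMeasure ν] (hnT : n ≤ T) {α : ℝ} (hα : 0 < α) :
    totalWeight α r σ u (fun ξ => (∫ v, |⟪ξ, (v : EuclideanSpace ℝ (Fin d))⟫| ^ α ∂ν) ^ (1 / α))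
      n T = lpNorm (fun p : ℝ × Metric.sphere (0 : EuclideanSpace ℝ (Fin d)) 1 =>
        discountedVolAlong r T σ u p.1.toNNReal p.2) (ENNReal.ofReal α)
        ((volume.restrict (Ioc (n : ℝ) T)).prod ν) := by
  have hmem := memLp_discountedVolAlong (r := r) (n := n) (ν := ν) hmarket hgrid hu
    (ENNReal.ofReal α)
  have hα0 : ENNReal.ofReal α ≠ 0 := by simpa using hα
  have hint := hmem.integrable_norm_rpow hα0 ENNReal.ofReal_ne_top
  rw [ENNReal.toReal_ofReal hα.le] at hint
  rw [lpNorm_eq_integral_norm_rpow_toReal hα0 ENNReal.ofReal_ne_top hmem.aestronglyMeasurable,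
    ENNReal.toReal_ofReal hα.le, integral_prod _ hint, totalWeight, one_div,
    intervalIntegral.integral_of_le (NNReal.coe_le_coe.2 hnT)]
  congr 1
  refine integral_congr_ae (ae_of_all _ fun s => ?_)
  have h0 : 0 ≤ ∫ v, |⟪direction r σ u T s.toNNReal, (v : EuclideanSpace ℝ (Fin d))⟫| ^ α ∂ν :=
    integral_nonneg fun v => by positivity
  simp only [discountedVolAlong_eq_inner, Real.norm_eq_abs]
  rw [← Real.rpow_mul h0, inv_mul_cancel₀ hα.ne', Real.rpow_one]

end SymmetricWeight

end

/-! ### Assembly of the three cases -/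

theorem proposition4p3 {Ω : Type*} {mΩ : MeasurableSpace Ω} (P : Measure Ω)
    [IsProbabilityMeasure P] (ℱ : Filtration ℝ≥0 mΩ) {d : ℕ} [NeZero d]
    (α : ℝ) (hα : α ∈ Ioc (1 : ℝ) 2)
    (L : ℝ≥0 → Ω → EuclideanSpace ℝ (Fin d)) (hL : IsLevyProcess ℱ L P) (hLα : IsAlphaStable α L P)
    -- the market, the time grid and the control
    (T : ℝ≥0) (r : ℝ) (μ : ℝ≥0 → Fin d → ℝ) (σ : ℝ≥0 → Matrix (Fin d) (Fin d) ℝ)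
    (hmarket : IsMarket T μ σ)
    {N : ℕ} (grid : Fin (N + 1) → ℝ≥0) (hgrid : IsGrid T grid) (k : Fin N)
    (n : ℝ≥0) (hn : n = grid k.castSucc)
    (M : ℝ) (hM : 0 < M) (u : ℝ≥0 → Fin d → ℝ) (hu : IsControl M grid u)
    -- the wealth process, started at some time `a ≤ n`
    (a : ℝ≥0) (ha : a ≤ n) (X : ℝ≥0 → Ω → ℝ) (hX : IsWealthProcess P ℱ L r μ σ u a T X)
    -- the risk measure
    (kind : TranslationKind) (ρ : RiskMeasure P ℱ T α kind) :
    IntervalIntegrable (fun s : ℝ => driftTerm kind r T μ u s.toNNReal) volume n T ∧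
    -- `α < 2`, symmetric
    (α < 2 → ∀ (c : ℝ) (_ : 0 < c)
      (ν : Measure (Metric.sphere (0 : EuclideanSpace ℝ (Fin d)) 1)) (_ : IsProbabilityMeasure ν),
      HasLevyMeasure L P (stableLevyMeasure α c ν) → IsSymmetricProcess L P →
      ∀ {Ω' : Type*} {mΩ' : MeasurableSpace Ω'} (P' : Measure Ω') (_ : IsProbabilityMeasure P')
        (ℱ' : Filtration ℝ≥0 mΩ') (L' : ℝ≥0 → Ω' → ℝ)
        (ν' : Measure (Metric.sphere (0 : ℝ) 1)) (_ : IsProbabilityMeasure ν'),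
        IsLevyProcess ℱ' L' P' → IsAlphaStable α L' P' →
        HasLevyMeasure L' P' (stableLevyMeasure α c ν') → IsSymmetricProcess L' P' →
        ρ.ofLaw (P'.map (L' 1)) < ⊤ →
        MemLp (fun p : ℝ × Metric.sphere (0 : EuclideanSpace ℝ (Fin d)) 1 =>
            discountedVolAlong r T σ u p.1.toNNReal p.2) (ENNReal.ofReal α)
          ((volume.restrict (Ioc (n : ℝ) T)).prod ν) ∧
        MemLp (fun s : ℝ => weightSymmetric α r T ν σ u s.toNNReal) (ENNReal.ofReal α)
          (volume.restrict (Ioc (n : ℝ) T)) ∧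
        ConditionalRiskEq ρ r X n (riskValue kind r μ u n T (ρ.ofLaw (P'.map (L' 1)))
          (lpNorm (fun p : ℝ × Metric.sphere (0 : EuclideanSpace ℝ (Fin d)) 1 =>
              discountedVolAlong r T σ u p.1.toNNReal p.2) (ENNReal.ofReal α)
            ((volume.restrict (Ioc (n : ℝ) T)).prod ν))) ∧
        ConditionalRiskEq ρ r X n (riskValue kind r μ u n T (ρ.ofLaw (P'.map (L' 1)))
          (lpNorm (fun s : ℝ => weightSymmetric α r T ν σ u s.toNNReal) (ENNReal.ofReal α)
            (volume.restrict (Ioc (n : ℝ) T))))) ∧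
    -- `α < 2`, one risky asset, no short selling
    (α < 2 → ∀ (c : ℝ) (_ : 0 < c)
      (ν : Measure (Metric.sphere (0 : EuclideanSpace ℝ (Fin d)) 1)) (_ : IsProbabilityMeasure ν),
      HasLevyMeasure L P (stableLevyMeasure α c ν) →
      d = 1 → (∀ s ∈ Ioc 0 T, 0 ≤ u s 0) →
      ρ.ofLaw (P.map (fun ω => L 1 ω 0)) < ⊤ →
        MemLp (fun s : ℝ => weightOneDim r T σ u s.toNNReal) (ENNReal.ofReal α)
          (volume.restrict (Ioc (n : ℝ) T)) ∧
        ConditionalRiskEq ρ r X n (riskValue kind r μ u n T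
          (ρ.ofLaw (P.map (fun ω => L 1 ω 0)))
          (lpNorm (fun s : ℝ => weightOneDim r T σ u s.toNNReal) (ENNReal.ofReal α)
            (volume.restrict (Ioc (n : ℝ) T))))) ∧
    -- `α = 2`, Brownian motion
    (α = 2 → HasBrownianMarginals L P → (∀ t ∈ Ioc 0 T, (corrMatrix L P t).PosDef) →
      ρ.ofLaw (P.map (fun ω => L 1 ω 0)) < ⊤ →
        MemLp (fun s : ℝ => weightBrownian (corrMatrix L P) r T σ u s.toNNReal) 2
          (volume.restrict (Ioc (n : ℝ) T)) ∧
        ConditionalRiskEq ρ r X n (riskValue kind r μ u n T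
          (ρ.ofLaw (P.map (fun ω => L 1 ω 0)))
          (√(∫ s in (n : ℝ)..T,
            weightBrownian (corrMatrix L P) r T σ u s.toNNReal ^ 2))) ∧
        ConditionalRiskEq ρ r X n (riskValue kind r μ u n T
          (ρ.ofLaw (P.map (fun ω => L 1 ω 0)))
          (lpNorm (fun s : ℝ => weightBrownian (corrMatrix L P) r T σ u s.toNNReal) 2
            (volume.restrict (Ioc (n : ℝ) T))))) := by
  have hα0 : 0 < α := one_pos.trans hα.1
  have hnT : n ≤ T := hn ▸ hgrid.le _
  refine ⟨intervalIntegrable_driftTerm hmarket hgrid hu kind r hnT, ?_, ?_, ?_⟩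
  · intro hα2 c _ ν _ hΛ hs Ω' _ P' _ ℱ' L' ν' _ hL' hLα' hΛ' hs' hρ
    have hQ := Measure.isProbabilityMeasure_map (μ := P') (hL'.measurable 1).aemeasurable
    have hwcont := (continuous_integral_abs_inner_rpow hα0 ν).rpow_const (p := 1 / α)
      fun _ => Or.inr (by positivity)
    have hf : ∀ s ∈ Ioc 0 T, weightSymmetric α r T ν σ u s =
        (∫ v, |⟪direction r σ u T s, (v : EuclideanSpace ℝ (Fin d))⟫| ^ α ∂ν) ^ (1 / α) :=
      fun s _ => weightSymmetric_eq hα0 s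
    have hrisk := hX.conditionalRiskEq hα0 (hLα'.isStrictlyStable hα0 hL')
      (isWeight_symmetric hα0 hα2 hL hLα hL' hLα' hΛ hs hΛ' hs') hL hLα hmarket hgrid hu
      (fun _ _ => mem_univ _) ha hnT ρ hρ
    refine ⟨memLp_discountedVolAlong hmarket hgrid hu _, memLp_weight hmarket hgrid hu hwcont hf _,
      ?_, ?_⟩
    · rwa [← totalWeight_eq_lpNorm_prod hmarket hgrid hu hnT hα0]
    · rwa [← totalWeight_eq_lpNorm hmarket hgrid hu hwcont hnT hf (fun _ _ => lpNorm_nonneg) hα0]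
  · intro hα2 c _ ν _ _ hd hu0 hρ
    subst hd
    have hQ := Measure.isProbabilityMeasure_map (μ := P) (f := fun ω => L 1 ω 0)
      ((EuclideanSpace.proj (𝕜 := ℝ) (0 : Fin 1)).measurable.comp (hL.measurable 1)).aemeasurable
    -- A nonnegative position times the positive volatility stays in the half-line on which the
    -- weight is valid.
    have hK : ∀ s ∈ Ioc 0 T, WithLp.toLp 2 (u s ᵥ* σ s) ∈
        {ξ : EuclideanSpace ℝ (Fin 1) | 0 ≤ ξ 0} := fun s hs => by
      have h : 0 ≤ u s 0 * σ s 0 0 :=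
        mul_nonneg (hu0 s hs) (hmarket.pos s ⟨zero_le, hs.2⟩ 0 0).le
      simpa [Matrix.vecMul, dotProduct] using h
    have hwcont : Continuous fun ξ : EuclideanSpace ℝ (Fin 1) => ξ 0 := by fun_prop
    have hf : ∀ s ∈ Ioc 0 T, weightOneDim r T σ u s = direction r σ u T s 0 := fun s _ => by
      simp [weightOneDim, direction, Matrix.vecMul, dotProduct]
      ring
    have hf0 : ∀ s ∈ Ioc 0 T, 0 ≤ weightOneDim r T σ u s := fun s hs =>
      mul_nonneg (mul_nonneg (hu0 s hs) (hmarket.pos s ⟨zero_le, hs.2⟩ 0 0).le)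
        (Real.exp_pos _).le
    have hrisk := hX.conditionalRiskEq hα0 (hLα.isStrictlyStable_coordinate hα0 hL 0)
      (isWeight_oneDim hL) hL hLα hmarket hgrid hu hK ha hnT ρ hρ
    refine ⟨memLp_weight hmarket hgrid hu hwcont hf _, ?_⟩
    rwa [← totalWeight_eq_lpNorm hmarket hgrid hu hwcont hnT hf hf0 hα0]
  · intro hα2 hW _ hρ
    subst hα2
    have hQ := Measure.isProbabilityMeasure_map (μ := P) (f := fun ω => L 1 ω 0)
      ((EuclideanSpace.proj (𝕜 := ℝ) (0 : Fin d)).measurable.comp (hL.measurable 1)).aemeasurable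
    have hw := hW.isWeight hL 0
    have hwcont := continuousOn_univ.1 hw.continuousOn
    -- Replacing `R_s` by `R_1` requires `s > 0`: at time `0` the variances vanish and the quotient
    -- defining the correlation degenerates.
    have hf : ∀ s ∈ Ioc 0 T, weightBrownian (corrMatrix L P) r T σ u s =
        √(direction r σ u T s ⬝ᵥ (corrMatrix L P 1 *ᵥ direction r σ u T s)) := fun s hs => by
      rw [weightBrownian, hW.corrMatrix_eq hL hLα hs.1]
      rfl
    have hrisk := hX.conditionalRiskEq hα0 (hLα.isStrictlyStable_coordinate hα0 hL 0)
      hw hL hLα hmarket hgrid hu (fun _ _ => mem_univ _) ha hnT ρ hρ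
    have htotal := totalWeight_eq_lpNorm hmarket hgrid hu hwcont hnT hf
      (fun _ _ => Real.sqrt_nonneg _) hα0
    have hsqrt : totalWeight 2 r σ u
        (fun ξ => √(ξ ⬝ᵥ (corrMatrix L P 1 *ᵥ ξ))) n T = √(∫ s in (n : ℝ)..T,
          weightBrownian (corrMatrix L P) r T σ u s.toNNReal ^ 2) := by
      rw [totalWeight, Real.sqrt_eq_rpow, intervalIntegral.integral_of_le
        (NNReal.coe_le_coe.2 hnT), intervalIntegral.integral_of_le (NNReal.coe_le_coe.2 hnT)]
      congr 1
      refine setIntegral_congr_fun measurableSet_Ioc fun s hs => ?_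
      have hs' : s.toNNReal ∈ Ioc 0 T :=
        ⟨Real.toNNReal_pos.2 (n.2.trans_lt hs.1), Real.toNNReal_le_iff_le_coe.2 hs.2⟩
      simp only [hf _ hs', Real.rpow_two]
    have hmem := memLp_weight (n := n) hmarket hgrid hu hwcont hf 2
    rw [ENNReal.ofReal_ofNat] at htotal
    refine ⟨hmem, ?_, ?_⟩
    · rwa [← hsqrt]
    · rwa [← htotal]
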